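/- **Model.** Let $N,K,R,T\in\mathbb N$ with $1\le K<N/2$, $R\ge 1$, and $\mathrm{SNR}>0$. Consider $R$ sparse linear regression problems with $T$ samples each, $$Y_{\{r\}} = X_{\{r\}}\beta_{\{r\}} + W_{\{r\}},\qquad r=1,\dots,R,$$ where $X_{\{r\}}\in\mathbb R^{T\times N}$ has IID $\mathcal N(0,1/T)$ entries, $W_{\{r\}}\in\mathbb R^T$ has IID $\mathcal N(0,1/\mathrm{SNR})$ entries, and all vectors $\beta_{\{r\}}\in\mathbb R^N$ have the same support $S$, which is uniformly distributed over the $K$-element subsets of $\{1,\dots,N\}$. The nonzero coefficients $\beta_{\{r\},k}$, $k\in S$, $1\le r\le R$, are IID with mean zero, variance $\sigma^2$ and $|\beta_{\{r\},k}|\ge b_{\min}>0$ almost surely. The support, the coefficients, the matrices and the noise are independent (within and across the $R$ problems). A decoder estimates $S$ from all $X_{\{r\}},Y_{\{r\}}$, and $P(E)$ denotes its average probability of error. For $v>0$ put $$T_o(v)=\frac{K\log(N/K)}{\log(1+v)},$$ so that, for a single problem ($R=1$), $T_o(\sigma^2)$ and $T_o(b_{\min}^2)$ are the necessary and the sufficient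 order of the sample complexity. **Theorem.** The sample complexity per problem for the $R$ problems is $T_o/R$, with constants that do not depend on $R$; here the SNR is measured by the total value $R\cdot\mathrm{SNR}$. Precisely: 1. (Necessary SNR.) There are absolute constants $c,\delta>0$ and $N_0$ such that for all $N\ge N_0$ and all $K,R,T,\mathrm{SNR}$ and coefficient laws as above, if $R\cdot\mathrm{SNR}< c\,\frac{\log N}{\sigma^2}$, then every decoder has $P(E)\ge\delta$. 2. (Necessary number of samples.) For every $\kappa>0$ there are $c,\delta>0$ and $N_0$, depending only on $\kappa$, such that for all $N\ge N_0$ and all $K,R,T,\mathrm{SNR}$ and coefficient laws as above with $R\cdot\mathrm{SNR}\le\kappa\log(N/K)$, if $T< c\,\frac{T_o(\sigma^2)}{R}$, then every decoder has $P(E)\ge\delta$. 3. (Sufficient number of samples.) There is an absolute constant $C>0$, and for every $b_{\min}>0$ there is $\kappa>0$ depending only on $b_{\min}$, such that for all fixed $K$, $R$ and every fixed coefficient law as above the following holds: for every $\epsilon>0$ there is $N_0$ such that for all $N\ge N_0$ with $N>2K$, all $\mathrm{SNR}$ with $R\cdot\mathrm{SNR}\ge\kappa\log N$ and all $T\ge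 C\,\frac{T_o(b_{\min}^2)}{R}$, there is a decoder with $P(E)<\epsilon$. -/

import Mathlib

open MeasureTheory ProbabilityTheory
open scoped NNReal

namespace MultiRegression

/-- The `R` variable matrices, each of size `T × N`; entry `X r t n`. -/
abbrev Design (R T N : ℕ) : Type := Fin R → Fin T → Fin N → ℝ

/-- The `R` outcome (or noise) vectors, each of length `T`. -/
abbrev Outcome (R T : ℕ) : Type := Fin R → Fin T → ℝ

/-- A family of `R` coefficient vectors of length `N`. -/
abbrev Coeff (R N : ℕ) : Type := Fin R → Fin N → ℝ

/-- `ν` is an admissible law of a nonzero coefficient: zero mean, variance `σsq`, and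
absolute value at least `bmin > 0` almost surely. -/
structure IsCoeffLaw (ν : Measure ℝ) (σsq bmin : ℝ) : Prop where
  isProbabilityMeasure : IsProbabilityMeasure ν
  memLp : MemLp (fun x : ℝ => x) 2 ν
  mean_eq_zero : ∫ x, x ∂ν = 0
  variance_eq : variance (fun x : ℝ => x) ν = σsq
  bmin_pos : 0 < bmin
  bmin_le : ∀ᵐ x ∂ν, bmin ≤ |x|

/-- All entries of all variable matrices are independent `N(0, 1/T)`. -/
noncomputable def designLaw (R T N : ℕ) : Measure (Design R T N) :=
  Measure.pi fun _ => Measure.pi fun _ => Measure.pi fun _ => gaussianReal 0 (T : ℝ≥0)⁻¹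

/-- All noise entries are independent `N(0, 1/SNR)`. -/
noncomputable def noiseLaw (R T : ℕ) (snr : ℝ≥0) : Measure (Outcome R T) :=
  Measure.pi fun _ => Measure.pi fun _ => gaussianReal 0 snr⁻¹

/-- Independent coefficients of law `ν`, for all problems and all indices. Only those with index
in the support enter the model, see `sparseCoeff`. -/
noncomputable def coeffLaw (R N : ℕ) (ν : Measure ℝ) : Measure (Coeff R N) :=
  Measure.pi fun _ => Measure.pi fun _ => ν

/-- Joint law of variable matrices, coefficients and noise, which are mutually independent. -/
noncomputable def modelLaw (R T N : ℕ) (snr : ℝ≥0) (ν : Measure ℝ) :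
    Measure (Design R T N × Coeff R N × Outcome R T) :=
  (designLaw R T N).prod ((coeffLaw R N ν).prod (noiseLaw R T snr))

/-- The `R` sparse vectors with common support `S`: the entries outside `S` are put to zero. -/
def sparseCoeff {R N : ℕ} (S : Finset (Fin N)) (γ : Coeff R N) : Coeff R N :=
  fun r n => if n ∈ S then γ r n else 0

/-- The outcomes `Y_r = X_r β_r + W_r` of the `R` linear regression problems with support `S`. -/
def outcome {R T N : ℕ} (S : Finset (Fin N)) (X : Design R T N) (γ : Coeff R N)
    (W : Outcome R T) : Outcome R T :=
  fun r t => ∑ n, X r t n * sparseCoeff S γ r n + W r t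

/-- A (measurable) decoder: it estimates the support from the `R` variable matrices and the
`R` outcome vectors. -/
structure Decoder (R T N : ℕ) where
  /-- The estimated support. -/
  estimate : Design R T N → Outcome R T → Finset (Fin N)
  measurableSet_fiber : ∀ S : Finset (Fin N),
    MeasurableSet {p : Design R T N × Outcome R T | estimate p.1 p.2 = S}

/-- Average probability of error of a decoder when the support is uniformly distributed over all
`K`-element subsets of the `N` indices. -/
noncomputable def errorProb {R T N : ℕ} (K : ℕ) (snr : ℝ≥0) (ν : Measure ℝ)
    (dec : Decoder R T N) : ℝ :=
  ∑ S ∈ Finset.powersetCard K (Finset.univ : Finset (Fin N)),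
    ((N.choose K : ℝ))⁻¹ * (modelLaw R T N snr ν).real
      {ω | dec.estimate ω.1 (outcome S ω.1 ω.2.1 ω.2.2) ≠ S}

/-- The single-problem sample complexity `K log (N/K) / log (1 + v)`; `v` is the variance of the
coefficients in the necessary condition and the square of their minimal modulus in the
sufficient one. -/
noncomputable def singleComplexity (N K : ℕ) (v : ℝ) : ℝ :=
  K * Real.log (N / K) / Real.log (1 + v)

end MultiRegression

namespace MultiRegression

/-! The `R` problems act like one problem with `R * T` samples and signal-to-noise ratio `R * snr`,
because relative entropies add over independent samples and exponential error bounds multiply over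
them.

Converse: given design and coefficients, the outcomes are Gaussian, and Fano's inequality
(`fano_successProb`) compares all candidate supports with one common Gaussian reference. If all
indices but one are known, the reference needs no extra noise and the mean relative entropy is at
most `R * snr * σsq / 2` for every `T`, against `log (N - K + 1)`. If nothing is known, raising the
reference variance by `K * σsq / T` gives the capacity `R * T / 2 * log (1 + K * snr * σsq / T)`,
against `log (N.choose K) ≥ K * log (N / K)`. When `R * snr ≤ κ * log (N / K)`, the capacity bound
depends on `u = R * T` through the increasing function `u * log (1 + a / u)`
(`mul_log_one_add_div_le`), so only the product `R * T` has to be large.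

Achievability: choose the support with the least total residual. For fixed design and coefficients,
`S'` beats `S` with probability at most `(1 + 2 ^ (K * R)) * exp (-snr * A / 32)`, where `A` is the
energy of the signal orthogonal to the columns in `S'` (`noiseLaw_residual_le`). Over the design,
that orthogonal part is a Gaussian vector in at least `T - K` dimensions
(`integral_exp_neg_residual_le`), so with `i = (S \ S').card` the exponential averages to at most
`(1 + snr * i * bmin ^ 2 / (16 * T)) ^ (-R * (T - K) / 2)`. This is at most `N ^ (-2 * i)` for the
stated sizes (`confusion_bound_le`), and the union bound leaves `O(1 / N)` for fixed `K` and `R`. -/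

/-- The Donsker–Varadhan inequality with constant `D`: a form of `KL(P ‖ Q) ≤ D` that is stable
under products. -/
def DonskerVaradhan {Ω : Type*} [MeasurableSpace Ω] (P Q : Measure Ω) (D : ℝ) : Prop :=
  ∀ f : Ω → ℝ, Measurable f → (∃ C, ∀ x, |f x| ≤ C) →
    ∫ x, f x ∂P ≤ D + Real.log (∫ x, Real.exp (f x) ∂Q)

/-! ### Relative entropy through bounded test functions: products and Gaussians. -/

section Bounded

variable {Ω : Type*} [MeasurableSpace Ω]

lemma integrable_of_abs_le {μ : Measure Ω} [IsFiniteMeasure μ] {f : Ω → ℝ} (hf : Measurable f)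
    {C : ℝ} (hC : ∀ x, |f x| ≤ C) : Integrable f μ :=
  Integrable.of_bound hf.aestronglyMeasurable C (ae_of_all _ hC)

lemma integrable_exp_of_abs_le {μ : Measure Ω} [IsFiniteMeasure μ] {f : Ω → ℝ}
    (hf : Measurable f) {C : ℝ} (hC : ∀ x, |f x| ≤ C) :
    Integrable (fun x => Real.exp (f x)) μ :=
  integrable_of_abs_le hf.exp (C := Real.exp C) fun x => by
    rw [abs_of_pos (Real.exp_pos _)]
    exact Real.exp_le_exp.2 (le_of_abs_le (hC x))

lemma abs_log_integral_exp_le {μ : Measure Ω} [IsProbabilityMeasure μ] {f : Ω → ℝ}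
    (hf : Measurable f) {C : ℝ} (hC : ∀ x, |f x| ≤ C) :
    |Real.log (∫ x, Real.exp (f x) ∂μ)| ≤ C := by
  have hi := integrable_exp_of_abs_le (μ := μ) hf hC
  have hlow : Real.exp (-C) ≤ ∫ x, Real.exp (f x) ∂μ := by
    have := integral_mono (integrable_const (Real.exp (-C))) hi
      (fun x => Real.exp_le_exp.2 (neg_le_of_abs_le (hC x)))
    simpa using this
  have hup : ∫ x, Real.exp (f x) ∂μ ≤ Real.exp C := by
    have := integral_mono hi (integrable_const (Real.exp C))
      (fun x => Real.exp_le_exp.2 (le_of_abs_le (hC x)))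
    simpa using this
  have hpos : 0 < ∫ x, Real.exp (f x) ∂μ := (Real.exp_pos _).trans_le hlow
  rw [abs_le]
  exact ⟨(Real.le_log_iff_exp_le hpos).2 hlow, (Real.log_le_iff_le_exp hpos).2 hup⟩

end Bounded

/-- Chain rule: the log-partition function `g` of the second coordinate is again bounded and
measurable, hence an admissible test function for the first. -/
lemma DonskerVaradhan.prod {Ω Ω' : Type*} [MeasurableSpace Ω] [MeasurableSpace Ω']
    {P Q : Measure Ω} {P' Q' : Measure Ω'} [IsProbabilityMeasure P] [IsProbabilityMeasure Q]
    [IsProbabilityMeasure P'] [IsProbabilityMeasure Q'] {D D' : ℝ}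
    (h : DonskerVaradhan P Q D) (h' : DonskerVaradhan P' Q' D') :
    DonskerVaradhan (P.prod P') (Q.prod Q') (D + D') := by
  rintro f hf ⟨C, hC⟩
  set g : Ω → ℝ := fun x => Real.log (∫ y, Real.exp (f (x, y)) ∂Q') with hg
  have hfx : ∀ x, Measurable fun y => f (x, y) := fun x => hf.comp measurable_prodMk_left
  have hgC : ∀ x, |g x| ≤ C := fun x => abs_log_integral_exp_le (hfx x) fun y => hC (x, y)
  have hgm : Measurable g := by
    have : StronglyMeasurable fun x => ∫ y, Real.exp (f (x, y)) ∂Q' :=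
      (hf.exp.stronglyMeasurable).integral_prod_right'
    exact Real.measurable_log.comp this.measurable
  have hpos : ∀ x, 0 < ∫ y, Real.exp (f (x, y)) ∂Q' := fun x =>
    integral_exp_pos (integrable_exp_of_abs_le (hfx x) fun y => hC (x, y))
  have hint : Integrable f (P.prod P') := integrable_of_abs_le hf hC
  calc ∫ z, f z ∂(P.prod P') = ∫ x, ∫ y, f (x, y) ∂P' ∂P := integral_prod f hint
    _ ≤ ∫ x, (D' + g x) ∂P := by
        refine integral_mono hint.integral_prod_left
          ((integrable_const _).add (integrable_of_abs_le hgm hgC)) fun x => ?_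
        exact h' _ (hfx x) ⟨C, fun y => hC (x, y)⟩
    _ = D' + ∫ x, g x ∂P := by
        rw [integral_add (integrable_const _) (integrable_of_abs_le hgm hgC)]
        simp
    _ ≤ D' + (D + Real.log (∫ x, Real.exp (g x) ∂Q)) := by
        gcongr
        exact h g hgm ⟨C, hgC⟩
    _ = D + D' + Real.log (∫ z, Real.exp (f z) ∂(Q.prod Q')) := by
        rw [integral_prod _ (integrable_exp_of_abs_le hf hC)]
        simp only [hg, Real.exp_log (hpos _)]
        ring

lemma DonskerVaradhan.map_equiv {Ω Ω' : Type*} [MeasurableSpace Ω] [MeasurableSpace Ω']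
    {P Q : Measure Ω} {P' Q' : Measure Ω'} {D : ℝ} (e : Ω ≃ᵐ Ω')
    (hP : MeasurePreserving e P P') (hQ : MeasurePreserving e Q Q')
    (h : DonskerVaradhan P' Q' D) : DonskerVaradhan P Q D := by
  rintro f hf ⟨C, hC⟩
  have := h (fun y => f (e.symm y)) (hf.comp e.symm.measurable) ⟨C, fun y => hC _⟩
  rw [← hP.integral_comp' (f := e), ← hQ.integral_comp' (f := e)] at this
  simpa using this

lemma DonskerVaradhan.pi {n : ℕ} {Ω : Type*} [MeasurableSpace Ω] {P Q : Fin n → Measure Ω}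
    [∀ i, IsProbabilityMeasure (P i)] [∀ i, IsProbabilityMeasure (Q i)] {D : Fin n → ℝ}
    (h : ∀ i, DonskerVaradhan (P i) (Q i) (D i)) :
    DonskerVaradhan (Measure.pi P) (Measure.pi Q) (∑ i, D i) := by
  induction n with
  | zero =>
    rintro f hf ⟨C, hC⟩
    rw [Measure.pi_of_empty P, Measure.pi_of_empty Q]
    simp
  | succ n ih =>
    have := (h 0).prod (ih (P := fun i => P i.succ) (Q := fun i => Q i.succ) fun i => h i.succ)
    rw [Fin.sum_univ_succ]
    exact this.map_equiv _ (measurePreserving_piFinSuccAbove P 0)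
      (measurePreserving_piFinSuccAbove Q 0)

lemma integral_sq_gaussianReal (m : ℝ) (v : ℝ≥0) : ∫ x, x ^ 2 ∂gaussianReal m v = v + m ^ 2 := by
  have h := variance_eq_sub (μ := gaussianReal m v) (memLp_id_gaussianReal (μ := m) (v := v) 2)
  simp only [variance_id_gaussianReal, Pi.pow_apply, id_eq, integral_id_gaussianReal] at h
  linarith

lemma integrable_sq_gaussianReal (m : ℝ) (v : ℝ≥0) :
    Integrable (fun x => x ^ 2) (gaussianReal m v) :=
  (memLp_id_gaussianReal (μ := m) (v := v) 2).integrable_sq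

lemma integrable_id_gaussianReal (m : ℝ) (v : ℝ≥0) :
    Integrable (fun x : ℝ => x) (gaussianReal m v) :=
  (memLp_id_gaussianReal (μ := m) (v := v) 2).integrable (by norm_num)

/-- The constant is the relative entropy of the two Gaussians. The inequality is Gibbs' variational
principle: apply `x + 1 ≤ exp x` to `f - ℓ - log I`, whose exponential has mean one under the first
law. -/
lemma donskerVaradhan_gaussianReal (m m' : ℝ) {v u : ℝ≥0} (hv : v ≠ 0) (hu : u ≠ 0) :
    DonskerVaradhan (gaussianReal m v) (gaussianReal m' u)
      ((Real.log (u / v) + (v + (m - m') ^ 2) / u - 1) / 2) := by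
  rintro f hf ⟨C, hC⟩
  have hv0 : (0 : ℝ) < v := by positivity
  have hu0 : (0 : ℝ) < u := by positivity
  -- The log-likelihood ratio of the first law to the second; its mean is the relative entropy, and
  -- `exp (-ℓ)` changes the first law into the second.
  set ℓ : ℝ → ℝ := fun x => Real.log (u / v) / 2 - (x - m) ^ 2 / (2 * v) + (x - m') ^ 2 / (2 * u)
    with hℓ
  have hℓm : Measurable ℓ := by fun_prop
  have i2 := integrable_sq_gaussianReal m v
  have i1 := integrable_id_gaussianReal m v
  have hℓx : ∀ x, ℓ x = (1 / (2 * u) - 1 / (2 * v)) * x ^ 2 + (m / v - m' / u) * x +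
      (Real.log (u / v) / 2 - m ^ 2 / (2 * v) + m' ^ 2 / (2 * u)) := fun x => by
    simp only [hℓ]; field_simp; ring
  have iℓ : Integrable ℓ (gaussianReal m v) := by
    rw [funext hℓx]
    exact ((i2.const_mul _).add (i1.const_mul _)).add (integrable_const _)
  have hD : ∫ x, ℓ x ∂(gaussianReal m v) =
      (Real.log (u / v) + (v + (m - m') ^ 2) / u - 1) / 2 := by
    simp_rw [hℓx]
    have i12 : Integrable (fun x : ℝ => (1 / (2 * u) - 1 / (2 * v)) * x ^ 2 +
        (m / v - m' / u) * x : ℝ → ℝ) (gaussianReal m v) := (i2.const_mul _).add (i1.const_mul _)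
    rw [integral_add i12 (integrable_const _),
      integral_add (i2.const_mul _) (i1.const_mul _), integral_const_mul, integral_const_mul,
      integral_sq_gaussianReal, integral_id_gaussianReal]
    simp only [integral_const, probReal_univ, smul_eq_mul, one_mul]
    field_simp
    ring
  have hpdf : ∀ x, gaussianPDFReal m v x * Real.exp (-ℓ x) = gaussianPDFReal m' u x := fun x => by
    simp only [gaussianPDFReal, hℓ]
    have h1 : Real.exp (-(Real.log (u / v) / 2)) = √(2 * Real.pi * v) / √(2 * Real.pi * u) := by
      rw [← Real.sqrt_div (by positivity), ← Real.exp_log (x := √(2 * Real.pi * v / _))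
        (by positivity), Real.log_sqrt (by positivity),
        show (2 * Real.pi * v / (2 * Real.pi * u) : ℝ) = (u / v : ℝ)⁻¹ by field_simp,
        Real.log_inv]
      ring_nf
    rw [show -(Real.log (u / v) / 2 - (x - m) ^ 2 / (2 * v) + (x - m') ^ 2 / (2 * u)) =
      -(Real.log (u / v) / 2) + (x - m) ^ 2 / (2 * v) + -(x - m') ^ 2 / (2 * u) by ring,
      Real.exp_add, Real.exp_add, h1]
    have h2 : Real.exp (-(x - m) ^ 2 / (2 * v)) * Real.exp ((x - m) ^ 2 / (2 * v)) = 1 := by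
      rw [← Real.exp_add, neg_div, neg_add_cancel, Real.exp_zero]
    have h3 : √(2 * Real.pi * v) ≠ 0 := by positivity
    calc _ = (√(2 * Real.pi * v))⁻¹ * √(2 * Real.pi * v) * (Real.exp (-(x - m) ^ 2 / (2 * v)) *
          Real.exp ((x - m) ^ 2 / (2 * v))) * ((√(2 * Real.pi * u))⁻¹ *
          Real.exp (-(x - m') ^ 2 / (2 * u))) := by ring
      _ = _ := by rw [h2, inv_mul_cancel₀ h3]; ring
  set I : ℝ := ∫ x, Real.exp (f x) ∂(gaussianReal m' u) with hI
  have hIpos : 0 < I := integral_exp_pos (integrable_exp_of_abs_le hf hC)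
  have hexp : ∀ x, Real.exp (f x - ℓ x - Real.log I) =
      I⁻¹ * (Real.exp (-ℓ x) * Real.exp (f x)) := fun x => by
    rw [show f x - ℓ x - Real.log I = -Real.log I + (-ℓ x + f x) by ring, Real.exp_add,
      Real.exp_add, Real.exp_neg (Real.log I), Real.exp_log hIpos]
  have hchange : ∫ x, Real.exp (-ℓ x) * Real.exp (f x) ∂(gaussianReal m v) = I := by
    rw [hI, integral_gaussianReal_eq_integral_smul hv, integral_gaussianReal_eq_integral_smul hu]
    congr 1 with x
    simp only [smul_eq_mul]
    rw [← mul_assoc, hpdf]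
  -- A non-integrable function has integral `0` by convention, which the positive value `I` rules
  -- out.
  have hint : Integrable (fun x => Real.exp (-ℓ x) * Real.exp (f x))
      (gaussianReal m v) := by
    by_contra hcon
    rw [integral_undef hcon] at hchange
    exact hIpos.ne hchange
  have hmain : ∫ x, (f x - ℓ x - Real.log I) ∂(gaussianReal m v) ≤
      ∫ x, (I⁻¹ * (Real.exp (-ℓ x) * Real.exp (f x)) - 1) ∂(gaussianReal m v) := by
    refine integral_mono (((integrable_of_abs_le hf hC).sub iℓ).sub (integrable_const _))
      ((hint.const_mul _).sub (integrable_const _)) fun x => ?_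
    have := Real.add_one_le_exp (f x - ℓ x - Real.log I)
    rw [hexp] at this
    simp only
    linarith
  have ifℓ : Integrable (fun x => f x - ℓ x) (gaussianReal m v) :=
    (integrable_of_abs_le hf hC).sub iℓ
  rw [integral_sub ifℓ (integrable_const _),
    integral_sub (integrable_of_abs_le hf hC) iℓ, integral_sub (hint.const_mul _)
    (integrable_const _), integral_const_mul, hchange, hD, inv_mul_cancel₀ hIpos.ne'] at hmain
  simp only [integral_const, probReal_univ, smul_eq_mul, one_mul] at hmain
  linarith

/-- The consequence of the Donsker–Varadhan inequality for events that Fano's inequality uses. -/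
lemma DonskerVaradhan.mul_measureReal_le {Ω : Type*} [MeasurableSpace Ω] {P Q : Measure Ω}
    [IsProbabilityMeasure P] [IsProbabilityMeasure Q] {D : ℝ} (h : DonskerVaradhan P Q D)
    {B : Set Ω} (hB : MeasurableSet B) {lam : ℝ} :
    lam * P.real B ≤ D + Real.exp lam * Q.real B := by
  have hm : Measurable (B.indicator fun _ => lam) := measurable_const.indicator hB
  have hb : ∀ x, |B.indicator (fun _ => lam) x| ≤ |lam| := fun x => by
    by_cases hx : x ∈ B <;> simp [hx]
  have key := h (B.indicator fun _ => lam) hm ⟨|lam|, hb⟩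
  have hexp : (fun x => Real.exp (B.indicator (fun _ => lam) x)) =
      fun x => 1 + B.indicator (fun _ => Real.exp lam - 1) x := by
    ext x
    by_cases hx : x ∈ B <;> simp [hx]
  have hI : ∫ x, Real.exp (B.indicator (fun _ => lam) x) ∂Q =
      1 + Q.real B * (Real.exp lam - 1) := by
    rw [hexp, integral_add (integrable_const _) ((integrable_const _).indicator hB),
      integral_indicator_const _ hB]
    simp
  have hpos : 0 < ∫ x, Real.exp (B.indicator (fun _ => lam) x) ∂Q :=
    integral_exp_pos (integrable_exp_of_abs_le hm hb)
  -- With `q = Q.real B`, this gives `log (1 + q * (exp lam - 1)) ≤ q * (exp lam - 1) ≤ q * exp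
  -- lam`.
  have hlog := Real.log_le_sub_one_of_pos hpos
  rw [integral_indicator_const _ hB, smul_eq_mul] at key
  rw [hI] at key hlog
  have h0 : 0 ≤ Q.real B := measureReal_nonneg
  linarith

/-! ### The model: outcomes, success probabilities, conditioning on design and coefficients. -/

variable {R T N : ℕ}

instance : IsProbabilityMeasure (designLaw R T N) := by unfold designLaw; infer_instance

instance (snr : ℝ≥0) : IsProbabilityMeasure (noiseLaw R T snr) := by
  unfold noiseLaw; infer_instance

instance (ν : Measure ℝ) [IsProbabilityMeasure ν] : IsProbabilityMeasure (coeffLaw R N ν) := by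
  unfold coeffLaw; infer_instance

instance (snr : ℝ≥0) (ν : Measure ℝ) [IsProbabilityMeasure ν] :
    IsProbabilityMeasure (modelLaw R T N snr ν) := by
  unfold modelLaw; infer_instance

/-- The noiseless outcomes. -/
def signal (S : Finset (Fin N)) (X : Design R T N) (γ : Coeff R N) : Outcome R T :=
  fun r t => ∑ n ∈ S, X r t n * γ r n

lemma outcome_eq_signal_add (S : Finset (Fin N)) (X : Design R T N) (γ : Coeff R N)
    (W : Outcome R T) : outcome S X γ W = fun r t => signal S X γ r t + W r t := by
  ext r t
  simp [outcome, signal, sparseCoeff, Finset.sum_ite_mem]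

lemma measurable_outcome (S : Finset (Fin N)) :
    Measurable fun ω : Design R T N × Coeff R N × Outcome R T =>
      outcome S ω.1 ω.2.1 ω.2.2 := by
  simp only [outcome_eq_signal_add, signal]
  fun_prop

lemma Decoder.measurableSet_estimate_outcome_eq (dec : Decoder R T N) (S S' : Finset (Fin N)) :
    MeasurableSet {ω : Design R T N × Coeff R N × Outcome R T |
      dec.estimate ω.1 (outcome S ω.1 ω.2.1 ω.2.2) = S'} :=
  (measurable_fst.prodMk (measurable_outcome S)) (dec.measurableSet_fiber S')

/-- The probability that the support `S` is decoded correctly. -/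
noncomputable def successProb (snr : ℝ≥0) (ν : Measure ℝ) (dec : Decoder R T N)
    (S : Finset (Fin N)) : ℝ :=
  (modelLaw R T N snr ν).real {ω | dec.estimate ω.1 (outcome S ω.1 ω.2.1 ω.2.2) = S}

lemma errorProb_eq {K : ℕ} (hK : K ≤ N) (snr : ℝ≥0) (ν : Measure ℝ) [IsProbabilityMeasure ν]
    (dec : Decoder R T N) :
    errorProb K snr ν dec = 1 - (N.choose K : ℝ)⁻¹ *
      ∑ S ∈ Finset.powersetCard K Finset.univ, successProb snr ν dec S := by
  have h0 : (N.choose K : ℝ) ≠ 0 := by exact_mod_cast (Nat.choose_pos hK).ne'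
  have h : ∀ S : Finset (Fin N), (modelLaw R T N snr ν).real
      {ω | dec.estimate ω.1 (outcome S ω.1 ω.2.1 ω.2.2) ≠ S} = 1 - successProb snr ν dec S :=
    fun S => probReal_compl_eq_one_sub (dec.measurableSet_estimate_outcome_eq S S)
  simp only [errorProb, h]
  rw [← Finset.mul_sum, Finset.sum_sub_distrib]
  simp only [Finset.sum_const, Finset.card_powersetCard, Finset.card_univ, Fintype.card_fin,
    nsmul_eq_mul, mul_one]
  rw [mul_sub, inv_mul_cancel₀ h0]

lemma noiseLaw_map_outcome (S : Finset (Fin N)) (X : Design R T N) (γ : Coeff R N) (snr : ℝ≥0) :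
    (noiseLaw R T snr).map (outcome S X γ) =
      Measure.pi fun r => Measure.pi fun t => gaussianReal (signal S X γ r t) snr⁻¹ := by
  have h : outcome S X γ = fun W r => (fun w t => signal S X γ r t + w t) (W r) := by
    ext W r t
    simp [outcome_eq_signal_add]
  rw [h, noiseLaw, Measure.pi_map_pi (f := fun r (w : Fin T → ℝ) t => signal S X γ r t + w t)
    fun r => Measurable.aemeasurable (by fun_prop)]
  congr 1 with r : 1
  rw [Measure.pi_map_pi (f := fun t w => signal S X γ r t + w) fun t => by fun_prop]
  congr 1 with t : 1
  rw [gaussianReal_map_const_add]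
  simp

lemma measureReal_prod_eq_integral {α β : Type*} [MeasurableSpace α] [MeasurableSpace β]
    (μ : Measure α) (ν : Measure β) [IsFiniteMeasure μ] [IsFiniteMeasure ν] {s : Set (α × β)}
    (hs : MeasurableSet s) : (μ.prod ν).real s = ∫ x, ν.real (Prod.mk x ⁻¹' s) ∂μ := by
  rw [← integral_indicator_one hs, integral_prod _ ((integrable_const 1).indicator hs)]
  congr 1 with x
  rw [← integral_indicator_one (measurable_prodMk_left hs)]
  rfl

lemma integrable_measureReal_prodMk {α β : Type*} [MeasurableSpace α] [MeasurableSpace β]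
    (μ : Measure α) (ν : Measure β) [IsFiniteMeasure μ] [IsProbabilityMeasure ν] {s : Set (α × β)}
    (hs : MeasurableSet s) : Integrable (fun x => ν.real (Prod.mk x ⁻¹' s)) μ :=
  integrable_of_abs_le (measurable_measure_prodMk_left hs).ennreal_toReal (C := 1) fun x => by
    rw [abs_of_nonneg measureReal_nonneg]
    exact measureReal_le_one

/-- Conditioning on design and coefficients leaves only Gaussian noise, the setting of both the
converse and the achievability bounds. -/
lemma modelLaw_real_eq_integral (snr : ℝ≥0) (ν : Measure ℝ) [IsProbabilityMeasure ν]
    {s : Set (Design R T N × Coeff R N × Outcome R T)} (hs : MeasurableSet s) :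
    (modelLaw R T N snr ν).real s = ∫ z, (noiseLaw R T snr).real {W | (z.1, z.2, W) ∈ s}
      ∂((designLaw R T N).prod (coeffLaw R N ν)) := by
  have h := (MeasureTheory.measurePreserving_prodAssoc (designLaw R T N) (coeffLaw R N ν)
    (noiseLaw R T snr)).measureReal_preimage hs.nullMeasurableSet
  rw [modelLaw, ← h, measureReal_prod_eq_integral _ _ (MeasurableEquiv.prodAssoc.measurable hs)]
  rfl

lemma integrable_modelLaw_section (snr : ℝ≥0) (ν : Measure ℝ) [IsProbabilityMeasure ν]
    {s : Set (Design R T N × Coeff R N × Outcome R T)} (hs : MeasurableSet s) :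
    Integrable (fun z : Design R T N × Coeff R N => (noiseLaw R T snr).real
      {W | (z.1, z.2, W) ∈ s}) ((designLaw R T N).prod (coeffLaw R N ν)) :=
  integrable_measureReal_prodMk _ (noiseLaw R T snr) (MeasurableEquiv.prodAssoc.measurable hs)

lemma integral_comp_measurePreserving {α β : Type*} [MeasurableSpace α] [MeasurableSpace β]
    {μ : Measure α} {ν : Measure β} {f : α → β} (hf : MeasurePreserving f μ ν) {g : β → ℝ}
    (hg : Measurable g) : ∫ x, g (f x) ∂μ = ∫ y, g y ∂ν := by
  rw [← hf.map_eq, integral_map hf.measurable.aemeasurable hg.aestronglyMeasurable]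

/-! ### The mean energy of the signal. -/

section SecondMoment

variable {ν : Measure ℝ} {σsq bmin : ℝ}

lemma IsCoeffLaw.integral_sq (h : IsCoeffLaw ν σsq bmin) : ∫ x, x ^ 2 ∂ν = σsq := by
  rw [← h.variance_eq, variance_of_integral_eq_zero h.memLp.aemeasurable h.mean_eq_zero]

lemma IsCoeffLaw.variance_pos (h : IsCoeffLaw ν σsq bmin) : 0 < σsq := by
  have := h.isProbabilityMeasure
  have hb : bmin ^ 2 ≤ ∫ x, x ^ 2 ∂ν := by
    have := integral_mono_ae (μ := ν) (integrable_const (bmin ^ 2)) h.memLp.integrable_sq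
      (h.bmin_le.mono fun x hx => by
        simp only
        rw [← sq_abs x]
        exact pow_le_pow_left₀ h.bmin_pos.le hx 2)
    simpa using this
  rw [h.integral_sq] at hb
  exact (pow_pos h.bmin_pos 2).trans_le hb

lemma measurePreserving_design_entry (r : Fin R) (t : Fin T) (n : Fin N) :
    MeasurePreserving (fun X : Design R T N => X r t n) (designLaw R T N)
      (gaussianReal 0 (T : ℝ≥0)⁻¹) :=
  (measurePreserving_eval (fun _ : Fin N => gaussianReal 0 (T : ℝ≥0)⁻¹) n).comp
    ((measurePreserving_eval (fun _ : Fin T => Measure.pi fun _ : Fin N =>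
      gaussianReal 0 (T : ℝ≥0)⁻¹) t).comp (measurePreserving_eval _ r))

lemma measurePreserving_coeff_row (ν : Measure ℝ) [IsProbabilityMeasure ν] (r : Fin R) :
    MeasurePreserving (fun γ : Coeff R N => γ r) (coeffLaw R N ν) (Measure.pi fun _ => ν) :=
  measurePreserving_eval _ r

lemma measurePreserving_coeff_entry (ν : Measure ℝ) [IsProbabilityMeasure ν] (r : Fin R)
    (n : Fin N) : MeasurePreserving (fun γ : Coeff R N => γ r n) (coeffLaw R N ν) ν :=
  (measurePreserving_eval _ n).comp (measurePreserving_coeff_row ν r)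

lemma IsCoeffLaw.integral_linear_sq (h : IsCoeffLaw ν σsq bmin) (a : Fin N → ℝ) :
    ∫ γ, (∑ n, a n * γ n) ^ 2 ∂(Measure.pi fun _ : Fin N => ν) = (∑ n, a n ^ 2) * σsq := by
  have := h.isProbabilityMeasure
  have hm : ∀ n, MemLp (fun x : ℝ => a n * x) 2 ν := fun n => h.memLp.const_mul _
  have hv := variance_sum_pi (μ := fun _ : Fin N => ν) (X := fun n x => a n * x) hm
  have hi : ∀ n, Integrable (fun γ : Fin N → ℝ => a n * γ n) (Measure.pi fun _ : Fin N => ν) :=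
    fun n => ((hm n).comp_measurePreserving (measurePreserving_eval _ n)).integrable (by norm_num)
  rw [variance_of_integral_eq_zero] at hv
  · simp only [Finset.sum_apply] at hv
    rw [hv, Finset.sum_mul]
    refine Finset.sum_congr rfl fun n _ => ?_
    rw [variance_const_mul, h.variance_eq]
  · exact Measurable.aemeasurable (by fun_prop)
  · simp only [Finset.sum_apply]
    rw [integral_finsetSum _ fun n _ => hi n]
    refine Finset.sum_eq_zero fun n _ => ?_
    rw [integral_const_mul, integral_comp_eval (μ := fun _ : Fin N => ν) (i := n)
      (f := fun x : ℝ => x) (by fun_prop), h.mean_eq_zero, mul_zero]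

lemma IsCoeffLaw.memLp_signal (h : IsCoeffLaw ν σsq bmin) (S : Finset (Fin N)) (r : Fin R)
    (t : Fin T) : MemLp (fun z : Design R T N × Coeff R N => signal S z.1 z.2 r t) 2
      ((designLaw R T N).prod (coeffLaw R N ν)) := by
  have := h.isProbabilityMeasure
  refine memLp_finsetSum _ fun n _ => ?_
  have hX : Integrable (fun X : Design R T N => X r t n ^ 2) (designLaw R T N) :=
    (measurePreserving_design_entry r t n).integrable_comp_of_integrable
      (integrable_sq_gaussianReal _ _)
  have hγ : Integrable (fun γ : Coeff R N => γ r n ^ 2) (coeffLaw R N ν) :=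
    (measurePreserving_coeff_entry ν r n).integrable_comp_of_integrable h.memLp.integrable_sq
  rw [memLp_two_iff_integrable_sq (by fun_prop)]
  simp only [mul_pow]
  exact hX.mul_prod hγ

lemma IsCoeffLaw.integral_signal_sq (h : IsCoeffLaw ν σsq bmin) (S : Finset (Fin N)) (r : Fin R)
    (t : Fin T) : ∫ z, signal S z.1 z.2 r t ^ 2 ∂((designLaw R T N).prod (coeffLaw R N ν)) =
      S.card * σsq / T := by
  have := h.isProbabilityMeasure
  rw [integral_prod _ (h.memLp_signal S r t).integrable_sq]
  have hin : ∀ X : Design R T N, ∫ γ, signal S X γ r t ^ 2 ∂(coeffLaw R N ν) =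
      ∑ n ∈ S, X r t n ^ 2 * σsq := fun X => by
    have hf : ∀ γ : Coeff R N, signal S X γ r t =
        ∑ n, (if n ∈ S then X r t n else 0) * γ r n := fun γ => by
      simp [signal, ite_mul, Finset.sum_ite_mem]
    simp only [hf]
    have := h.integral_linear_sq fun n => if n ∈ S then X r t n else 0
    rw [← integral_comp_measurePreserving (measurePreserving_coeff_row ν r) (by fun_prop)] at this
    rw [this, ← Finset.sum_mul]
    simp [ite_pow, Finset.sum_ite_mem]
  simp only [hin]
  have hX : ∀ n, ∫ X, X r t n ^ 2 * σsq ∂(designLaw R T N) = σsq / T := fun n => by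
    have := integral_sq_gaussianReal 0 (T : ℝ≥0)⁻¹
    rw [← integral_comp_measurePreserving (measurePreserving_design_entry r t n)
      (by fun_prop)] at this
    rw [integral_mul_const, this]
    simp [div_eq_inv_mul]
  have hXi : ∀ n, Integrable (fun X : Design R T N => X r t n ^ 2 * σsq) (designLaw R T N) :=
    fun n => Integrable.mul_const
      ((measurePreserving_design_entry r t n).integrable_comp_of_integrable
        (integrable_sq_gaussianReal _ _)) _
  rw [integral_finsetSum _ fun n _ => hXi n]
  simp only [hX, Finset.sum_const, nsmul_eq_mul, mul_div_assoc]

end SecondMoment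

/-! ### Fano's inequality. -/

lemma sum_measureReal_fiber_le_one {Ω ι : Type*} [MeasurableSpace Ω] [DecidableEq ι]
    (μ : Measure Ω) [IsProbabilityMeasure μ] (f : Ω → ι) (hf : ∀ i, MeasurableSet {ω | f ω = i})
    (s : Finset ι) : ∑ i ∈ s, μ.real {ω | f ω = i} ≤ 1 := by
  rw [← measureReal_biUnion_finset _ fun i _ => hf i]
  · exact measureReal_le_one
  · intro i _ j _ hij
    exact Set.disjoint_left.2 fun ω hi hj => hij (hi.symm.trans hj)

/-- Fano's inequality for the supports in `𝒯`, which all consist of a known part `U` and of `j`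
further indices. The reference law of the outcomes has the signal of `U` as its mean, and the
noise variance increased by `d`. -/
lemma fano_successProb {K : ℕ} {snr : ℝ≥0} (hsnr : 0 < snr) {ν : Measure ℝ} {σsq bmin : ℝ}
    (h : IsCoeffLaw ν σsq bmin) (dec : Decoder R T N) (𝒯 : Finset (Finset (Fin N)))
    (U : Finset (Fin N)) (hU : ∀ S ∈ 𝒯, U ⊆ S) (hK : ∀ S ∈ 𝒯, (S \ U).card = K) (d : ℝ≥0)
    (lam : ℝ) :
    lam * ∑ S ∈ 𝒯, successProb snr ν dec S ≤
      𝒯.card * (R * T * ((Real.log (((snr : ℝ)⁻¹ + d) / (snr : ℝ)⁻¹) +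
        ((snr : ℝ)⁻¹ + K * σsq / T) / ((snr : ℝ)⁻¹ + d) - 1) / 2)) + Real.exp lam := by
  classical
  have := h.isProbabilityMeasure
  set μ := (designLaw R T N).prod (coeffLaw R N ν) with hμ
  set w : ℝ≥0 := snr⁻¹ with hw
  have hw0 : w ≠ 0 := (inv_pos.2 hsnr).ne'
  have hwd0 : w + d ≠ 0 := (add_pos_of_pos_of_nonneg (inv_pos.2 hsnr) zero_le).ne'
  set D : Finset (Fin N) → Design R T N × Coeff R N → ℝ := fun S z => ∑ r, ∑ t,
    (Real.log ((w + d : ℝ≥0) / w) + (w + signal (S \ U) z.1 z.2 r t ^ 2) / (w + d : ℝ≥0) - 1) / 2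
    with hD
  set p : Finset (Fin N) → Design R T N × Coeff R N → ℝ := fun S z =>
    (noiseLaw R T snr).real {W | dec.estimate z.1 (outcome S z.1 z.2 W) = S} with hp
  have hpt : ∀ z, ∑ S ∈ 𝒯, lam * p S z ≤ ∑ S ∈ 𝒯, D S z + Real.exp lam := by
    intro z
    -- The reference may depend on design and coefficients but not on `S`; the disjoint decoding
    -- regions then share a total mass of at most one.
    set Q := Measure.pi fun r => Measure.pi fun t =>
      gaussianReal (signal U z.1 z.2 r t) (w + d) with hQ
    have hfib : ∀ S, MeasurableSet {y | dec.estimate z.1 y = S} := fun S =>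
      measurable_prodMk_left (dec.measurableSet_fiber S)
    have hS : ∀ S ∈ 𝒯,
        lam * p S z ≤ D S z + Real.exp lam * Q.real {y | dec.estimate z.1 y = S} := by
      intro S hS
      have hmeas : Measurable (outcome S z.1 z.2) := by
        have := measurable_outcome (R := R) (T := T) (N := N) S
        exact this.comp (g := fun ω : Design R T N × Coeff R N × Outcome R T =>
          outcome S ω.1 ω.2.1 ω.2.2) (f := fun W => (z.1, z.2, W)) (by fun_prop)
      have hmap : p S z = (Measure.pi fun r => Measure.pi fun t =>
          gaussianReal (signal S z.1 z.2 r t) w).real {y | dec.estimate z.1 y = S} := by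
        rw [← noiseLaw_map_outcome, map_measureReal_apply hmeas (hfib S)]
        rfl
      have hdv := (DonskerVaradhan.pi fun r => DonskerVaradhan.pi fun t =>
        donskerVaradhan_gaussianReal (signal S z.1 z.2 r t) (signal U z.1 z.2 r t) hw0
          hwd0).mul_measureReal_le (hfib S) (lam := lam)
      rw [hmap]
      refine hdv.trans_eq ?_
      congr 1
      refine Finset.sum_congr rfl fun r _ => Finset.sum_congr rfl fun t _ => ?_
      have : signal (S \ U) z.1 z.2 r t = signal S z.1 z.2 r t - signal U z.1 z.2 r t := by
        simp only [signal]
        rw [← Finset.sum_sdiff (hU S hS)]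
        ring
      rw [this]
    calc ∑ S ∈ 𝒯, lam * p S z
        ≤ ∑ S ∈ 𝒯, (D S z + Real.exp lam * Q.real {y | dec.estimate z.1 y = S}) :=
          Finset.sum_le_sum hS
      _ = ∑ S ∈ 𝒯, D S z + Real.exp lam * ∑ S ∈ 𝒯, Q.real {y | dec.estimate z.1 y = S} := by
          rw [Finset.sum_add_distrib, Finset.mul_sum]
      _ ≤ ∑ S ∈ 𝒯, D S z + Real.exp lam * 1 := by
          gcongr
          exact sum_measureReal_fiber_le_one Q _ hfib 𝒯
      _ = _ := by rw [mul_one]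
  have hpi : ∀ S, Integrable (p S) μ := fun S =>
    integrable_modelLaw_section snr ν (dec.measurableSet_estimate_outcome_eq S S)
  have hsq : ∀ S r t, Integrable (fun z : Design R T N × Coeff R N =>
      signal S z.1 z.2 r t ^ 2) μ := fun S r t => (h.memLp_signal S r t).integrable_sq
  have hterm : ∀ S r t, Integrable (fun z : Design R T N × Coeff R N =>
      (Real.log ((w + d : ℝ≥0) / w) + (w + signal S z.1 z.2 r t ^ 2) / (w + d : ℝ≥0) - 1) / 2) μ :=
    fun S r t => (((integrable_const _).add (((integrable_const _).add
      (hsq S r t)).div_const _)).sub (integrable_const _)).div_const _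
  have hDi : ∀ S, Integrable (D S) μ := fun S =>
    integrable_finsetSum _ fun r _ => integrable_finsetSum _ fun t _ => hterm _ r t
  have hDint : ∀ S ∈ 𝒯, ∫ z, D S z ∂μ = R * T * ((Real.log ((w + d : ℝ≥0) / w) +
      (w + K * σsq / T) / (w + d : ℝ≥0) - 1) / 2) := by
    intro S hS
    simp only [hD]
    rw [integral_finsetSum _ fun r _ => integrable_finsetSum _ fun t _ => hterm _ r t]
    have : ∀ r : Fin R, ∀ t : Fin T, ∫ z : Design R T N × Coeff R N,
        (Real.log ((w + d : ℝ≥0) / w) + (w + signal (S \ U) z.1 z.2 r t ^ 2) / (w + d : ℝ≥0) - 1)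
          / 2 ∂μ = (Real.log ((w + d : ℝ≥0) / w) +
      (w + K * σsq / T) / (w + d : ℝ≥0) - 1) / 2 := by
      intro r t
      have e : ∀ z : Design R T N × Coeff R N, (Real.log ((w + d : ℝ≥0) / w) +
          (w + signal (S \ U) z.1 z.2 r t ^ 2) / (w + d : ℝ≥0) - 1) / 2 =
          (Real.log ((w + d : ℝ≥0) / w) + w / (w + d : ℝ≥0) - 1) / 2 +
            (2 * (w + d : ℝ≥0) : ℝ)⁻¹ * signal (S \ U) z.1 z.2 r t ^ 2 := fun z => by
        field_simp; ring
      simp only [e]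
      rw [integral_add (integrable_const _) ((hsq _ r t).const_mul _), integral_const_mul,
        h.integral_signal_sq, hK S hS]
      simp only [integral_const, probReal_univ, smul_eq_mul, one_mul]
      field_simp
      ring
    simp_rw [integral_finsetSum _ fun t _ => hterm _ _ t, this]
    simp [mul_assoc]
  -- Averaging over design and coefficients replaces each squared signal of `S \ U` by its mean `K *
  -- σsq / T`.
  have hint := integral_mono (μ := μ)
    (integrable_finsetSum 𝒯 fun S _ => (hpi S).const_mul lam)
    ((integrable_finsetSum 𝒯 fun S _ => hDi S).add (integrable_const (Real.exp lam))) hpt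
  have hl : ∫ z, ∑ S ∈ 𝒯, lam * p S z ∂μ = lam * ∑ S ∈ 𝒯, successProb snr ν dec S := by
    rw [integral_finsetSum _ fun S _ => (hpi S).const_mul lam, Finset.mul_sum]
    refine Finset.sum_congr rfl fun S _ => ?_
    rw [integral_const_mul, successProb,
      modelLaw_real_eq_integral snr ν (dec.measurableSet_estimate_outcome_eq S S)]
    rfl
  have hr : ∫ z, (∑ S ∈ 𝒯, D S z + Real.exp lam) ∂μ =
      𝒯.card * (R * T * ((Real.log ((w + d : ℝ≥0) / w) +
      (w + K * σsq / T) / (w + d : ℝ≥0) - 1) / 2)) + Real.exp lam := by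
    rw [integral_add (integrable_finsetSum 𝒯 fun S _ => hDi S) (integrable_const _),
      integral_finsetSum _ fun S _ => hDi S, Finset.sum_congr rfl hDint]
    simp
  simp only [Pi.add_apply] at hint
  rw [hl, hr] at hint
  simpa [hw] using hint

/-! ### Necessary SNR. -/

/-- Double counting of pairs of a support and one of its elements; it averages the bound with one
unknown index over all known parts `U`. -/
lemma sum_powersetCard_mul_eq_sum_insert (K : ℕ) (f : Finset (Fin N) → ℝ) :
    ((K + 1 : ℕ) : ℝ) * ∑ S ∈ Finset.powersetCard (K + 1) Finset.univ, f S =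
      ∑ U ∈ Finset.powersetCard K Finset.univ, ∑ k ∈ Uᶜ, f (insert k U) := by
  have h1 : ((K + 1 : ℕ) : ℝ) * ∑ S ∈ Finset.powersetCard (K + 1) Finset.univ, f S =
      ∑ S ∈ Finset.powersetCard (K + 1) Finset.univ, ∑ k ∈ S, f S := by
    rw [Finset.mul_sum]
    refine Finset.sum_congr rfl fun S hS => ?_
    rw [Finset.sum_const, (Finset.mem_powersetCard.1 hS).2, nsmul_eq_mul]
  rw [h1, Finset.sum_sigma', Finset.sum_sigma']
  refine Finset.sum_bij' (fun p _ => ⟨p.1.erase p.2, p.2⟩) (fun p _ => ⟨insert p.2 p.1, p.2⟩)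
    ?_ ?_ ?_ ?_ ?_
  · rintro ⟨S, k⟩ h
    simp only [Finset.mem_sigma, Finset.mem_powersetCard_univ] at h
    simp [Finset.card_erase_of_mem h.2, h.1]
  · rintro ⟨S, k⟩ h
    simp only [Finset.mem_sigma, Finset.mem_powersetCard_univ, Finset.mem_compl] at h
    simp [Finset.card_insert_of_notMem h.2, h.1]
  · rintro ⟨S, k⟩ h
    simp only [Finset.mem_sigma] at h
    simp [Finset.insert_erase h.2]
  · rintro ⟨S, k⟩ h
    simp only [Finset.mem_sigma, Finset.mem_compl] at h
    simp [Finset.erase_insert h.2]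
  · rintro ⟨S, k⟩ h
    simp only [Finset.mem_sigma] at h
    simp [Finset.insert_erase h.2]

/-- Fano's inequality when all indices of the support but one are known to the decoder. -/
lemma log_mul_sum_successProb_insert_le {snr : ℝ≥0} (hsnr : 0 < snr) {ν : Measure ℝ}
    {σsq bmin : ℝ} (h : IsCoeffLaw ν σsq bmin) (dec : Decoder R T N) (U : Finset (Fin N))
    (hU : U.card < N) :
    Real.log (N - U.card : ℕ) * ∑ k ∈ Uᶜ, successProb snr ν dec (insert k U) ≤
      (N - U.card : ℕ) * (R * snr * σsq / 2 + 1) := by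
  have hinj : Set.InjOn (fun k => insert k U) (Uᶜ : Finset (Fin N)) := by
    intro a ha b hb hab
    rw [Finset.mem_coe, Finset.mem_compl] at ha hb
    have hab' : insert a U = insert b U := hab
    have : a ∈ insert b U := hab' ▸ Finset.mem_insert_self a U
    exact (Finset.mem_insert.1 this).resolve_right ha
  -- With `d = 0` the relative entropy is just the energy of one column over the noise variance.
  -- Taking `lam` to be the log of the number of candidates makes `exp lam` equal to that number.
  have key := fano_successProb hsnr h dec (Uᶜ.image fun k => insert k U) U (K := 1)
    (by simp only [Finset.mem_image]; rintro _ ⟨k, -, rfl⟩; exact Finset.subset_insert _ _)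
    (by
      simp only [Finset.mem_image, Finset.mem_compl]
      rintro _ ⟨k, hk, rfl⟩
      rw [Finset.insert_sdiff_of_notMem _ hk]
      simp) 0 (Real.log (N - U.card : ℕ))
  have hcard : (Uᶜ).card = N - U.card := by simp [Finset.card_compl]
  have hpos : (0 : ℝ) < (N - U.card : ℕ) := by exact_mod_cast Nat.sub_pos_of_lt hU
  have hs : (0 : ℝ) < snr := by exact_mod_cast hsnr
  rw [Finset.sum_image hinj, Finset.card_image_of_injOn hinj, hcard, Real.exp_log hpos] at key
  refine key.trans ?_
  have hσ := h.variance_pos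
  simp only [NNReal.coe_zero, add_zero, Nat.cast_one, one_mul]
  rw [div_self (by positivity : (snr : ℝ)⁻¹ ≠ 0), Real.log_one]
  -- The column energy per sample is of order `1 / T`, so the `T` samples cancel it.
  have hD : (R * T * ((0 + ((snr : ℝ)⁻¹ + σsq / T) / (snr : ℝ)⁻¹ - 1) / 2) : ℝ) ≤
      R * snr * σsq / 2 := by
    rcases Nat.eq_zero_or_pos T with rfl | hT
    · simp only [Nat.cast_zero, mul_zero, zero_mul]
      positivity
    · have : (0 : ℝ) < T := by exact_mod_cast hT
      apply le_of_eq
      field_simp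
      ring
  nlinarith

/-- If the total signal-to-noise ratio is small compared with `log N / σ²`, every decoder errs. -/
theorem half_le_errorProb_of_snr_lt {K : ℕ} {snr : ℝ≥0} {ν : Measure ℝ} {σsq bmin : ℝ}
    (hN : 6 ≤ Real.log N) (hK : 1 ≤ K) (hKN : 2 * K < N) (hsnr : 0 < snr)
    (h : IsCoeffLaw ν σsq bmin) (hR : (R : ℝ) * snr < 1 / 2 * (Real.log N / σsq))
    (dec : Decoder R T N) : 1 / 2 ≤ errorProb K snr ν dec := by
  have := h.isProbabilityMeasure
  have hσ := h.variance_pos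
  obtain ⟨k, rfl⟩ : ∃ k, K = k + 1 := ⟨K - 1, by omega⟩
  have hM : (0 : ℝ) < (N - k : ℕ) := by exact_mod_cast (by omega : 0 < N - k)
  have hlogM : Real.log N - Real.log 2 ≤ Real.log (N - k : ℕ) := by
    have hN0 : (0 : ℝ) < N := by exact_mod_cast (by omega : 0 < N)
    rw [← Real.log_div hN0.ne' two_ne_zero]
    refine Real.log_le_log (by positivity) ?_
    rw [div_le_iff₀ two_pos]
    exact_mod_cast (by omega : N ≤ (N - k) * 2)
  have hl2 := Real.log_two_lt_d9
  -- `log N / 4 + 1 ≤ (log N - log 2) / 2` holds as soon as `log N ≥ 6`.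
  have hD : R * snr * σsq / 2 + 1 ≤ 1 / 2 * Real.log (N - k : ℕ) := by
    have : R * snr * σsq ≤ 1 / 2 * Real.log N := by
      have := mul_le_mul_of_nonneg_right hR.le hσ.le
      rwa [mul_assoc (1 / 2 : ℝ), div_mul_cancel₀ _ hσ.ne'] at this
    linarith
  have hU : ∀ U ∈ Finset.powersetCard k (Finset.univ : Finset (Fin N)),
      ∑ i ∈ Uᶜ, successProb snr ν dec (insert i U) ≤ (N - k : ℕ) * (1 / 2) := by
    intro U hU
    have hc := (Finset.mem_powersetCard.1 hU).2
    have := log_mul_sum_successProb_insert_le hsnr h dec U (by omega)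
    rw [hc] at this
    refine le_of_mul_le_mul_left (this.trans ?_) (by linarith : 0 < Real.log (N - k : ℕ))
    calc _ ≤ ((N - k : ℕ) : ℝ) * (1 / 2 * Real.log (N - k : ℕ)) := by gcongr
      _ = _ := by ring
  have hsum := Finset.sum_le_sum hU
  rw [← sum_powersetCard_mul_eq_sum_insert] at hsum
  simp only [Finset.sum_const, Finset.card_powersetCard, Finset.card_univ, Fintype.card_fin,
    nsmul_eq_mul] at hsum
  have hch : (N.choose (k + 1) : ℝ) * (k + 1 : ℕ) = N.choose k * (N - k : ℕ) := by
    exact_mod_cast Nat.choose_succ_right_eq N k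
  have hc0 : (0 : ℝ) < N.choose (k + 1) := by exact_mod_cast Nat.choose_pos (by omega)
  have hk0 : (0 : ℝ) < (k + 1 : ℕ) := by positivity
  rw [errorProb_eq (by omega)]
  have : ∑ S ∈ Finset.powersetCard (k + 1) Finset.univ, successProb snr ν dec S ≤
      N.choose (k + 1) * (1 / 2) := by
    refine le_of_mul_le_mul_left (hsum.trans_eq ?_) hk0
    linear_combination -(1 / 2 : ℝ) * hch
  have : (N.choose (k + 1) : ℝ)⁻¹ * ∑ S ∈ Finset.powersetCard (k + 1) Finset.univ,
      successProb snr ν dec S ≤ 1 / 2 := by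
    rw [inv_mul_le_iff₀ hc0]
    exact this
  linarith

/-! ### Necessary number of samples. -/

/-- Induction works because the ratio `(N + 1) / (K + 1)` of consecutive binomials is at most `N /
K` and at least the new base. -/
lemma div_pow_le_choose {N K : ℕ} (hK : 1 ≤ K) (hKN : K ≤ N) :
    ((N : ℝ) / K) ^ K ≤ N.choose K := by
  induction K, hK using Nat.le_induction generalizing N with
  | base => simp
  | succ K hK ih =>
    obtain ⟨N, rfl⟩ : ∃ n, N = n + 1 := ⟨N - 1, by omega⟩
    have hle : K ≤ N := by omega
    have h := ih hle
    have hK0 : (0 : ℝ) < K := by exact_mod_cast hK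
    have hNK : (K : ℝ) ≤ N := by exact_mod_cast hle
    have hch : ((N + 1 : ℕ) : ℝ) * N.choose K = (N + 1).choose (K + 1) * (K + 1 : ℕ) := by
      exact_mod_cast Nat.add_one_mul_choose_eq N K
    have hch' : ((N + 1).choose (K + 1) : ℝ) = ((N + 1 : ℕ) : ℝ) / (K + 1 : ℕ) * N.choose K := by
      field_simp
      linarith
    rw [hch', pow_succ']
    gcongr
    refine le_trans ?_ h
    gcongr ?_ ^ K
    rw [div_le_div_iff₀ (by positivity) hK0]
    push_cast
    nlinarith

/-- Fano's inequality, with the information bounded by the capacity of Gaussian channels. -/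
lemma log_choose_mul_sum_successProb_le {K : ℕ} (hKN : K ≤ N) {snr : ℝ≥0} (hsnr : 0 < snr)
    {ν : Measure ℝ} {σsq bmin : ℝ} (h : IsCoeffLaw ν σsq bmin) (dec : Decoder R T N) :
    Real.log (N.choose K) * ∑ S ∈ Finset.powersetCard K Finset.univ, successProb snr ν dec S ≤
      N.choose K * (R * T / 2 * Real.log (1 + K * snr * σsq / T) + 1) := by
  have hσ := h.variance_pos
  have hc : (0 : ℝ) < N.choose K := by exact_mod_cast Nat.choose_pos hKN
  have hs : (0 : ℝ) < snr := by exact_mod_cast hsnr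
  -- The added variance equals the mean signal energy per sample, so the non-logarithmic terms
  -- cancel and the Gaussian capacity remains.
  have key := fano_successProb hsnr h dec (Finset.powersetCard K Finset.univ) ∅ (K := K)
    (fun _ _ => Finset.empty_subset _)
    (fun S hS => by simpa using hS)
    (K * σsq / T).toNNReal (Real.log (N.choose K))
  rw [Real.exp_log hc, Finset.card_powersetCard, Finset.card_univ, Fintype.card_fin,
    Real.coe_toNNReal _ (by positivity)] at key
  refine key.trans_eq ?_
  have h1 : ((snr : ℝ)⁻¹ + K * σsq / T) / ((snr : ℝ)⁻¹ + K * σsq / T) = 1 :=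
    div_self (by positivity)
  have h2 : ((snr : ℝ)⁻¹ + K * σsq / T) / (snr : ℝ)⁻¹ = 1 + K * snr * σsq / T := by
    field_simp
  rw [h1, h2]
  ring

lemma log_one_add_le_two_mul_sqrt {x : ℝ} (hx : 0 ≤ x) : Real.log (1 + x) ≤ 2 * √x := by
  have h0 := Real.sqrt_nonneg x
  have h1 : 1 + x ≤ (1 + √x) ^ 2 := by nlinarith [Real.sq_sqrt hx]
  calc Real.log (1 + x) ≤ Real.log ((1 + √x) ^ 2) := Real.log_le_log (by linarith) h1
    _ = 2 * Real.log (1 + √x) := by rw [Real.log_pow]; norm_num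
    _ ≤ 2 * √x := by
      have := Real.log_le_sub_one_of_pos (by linarith : 0 < 1 + √x)
      linarith

/-- Spreading a fixed total energy `a` over more samples increases the capacity. This is Bernoulli's
inequality with exponent `u / u₀ ≤ 1`. The converse uses it to bound the capacity from above, the
achievability part to bound the exponent from below. -/
lemma mul_log_one_add_div_le {u u₀ a : ℝ} (hu : 0 < u) (hle : u ≤ u₀) (ha : 0 ≤ a) :
    u * Real.log (1 + a / u) ≤ u₀ * Real.log (1 + a / u₀) := by
  have hu₀ := hu.trans_le hle
  have h := rpow_one_add_le_one_add_mul_self (s := a / u) (p := u / u₀)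
    (by linarith [show 0 ≤ a / u by positivity]) (by positivity) ((div_le_one hu₀).2 hle)
  have h2 := Real.log_le_log (by positivity) h
  rw [Real.log_rpow (by positivity)] at h2
  have e : u / u₀ * (a / u) = a / u₀ := by field_simp
  rw [e] at h2
  calc u * Real.log (1 + a / u) = u₀ * (u / u₀ * Real.log (1 + a / u)) := by field_simp
    _ ≤ _ := by gcongr

/-- One constant must serve all variances `s`. Below `s₀` the linear bound on the logarithm
suffices. Above it the argument grows at most like `(1 + κ / c) * (1 + s) ^ 2`, and `log (1 + s)`
stays away from zero. -/
lemma exists_capacity_constant {κ : ℝ} (hκ : 0 < κ) : ∃ c : ℝ, 0 < c ∧ ∀ s : ℝ, 0 < s →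
    c / Real.log (1 + s) * Real.log (1 + κ * s * Real.log (1 + s) / c) ≤ 1 / 2 := by
  set s₀ : ℝ := 1 / (2 * κ) with hs₀
  have hs₀pos : 0 < s₀ := by positivity
  set ℓ := Real.log (1 + s₀) with hℓ
  have hℓpos : 0 < ℓ := Real.log_pos (by linarith)
  -- For `s ≥ s₀` the total is at most `2 * √(c * κ) / ℓ + 2 * c`; each bound on `c` makes one
  -- summand at most `1 / 4`.
  set c := min (1 / 8) (ℓ ^ 2 / (64 * κ)) with hc
  have hcpos : 0 < c := lt_min (by norm_num) (by positivity)
  refine ⟨c, hcpos, fun s hs => ?_⟩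
  have hlpos : 0 < Real.log (1 + s) := Real.log_pos (by linarith)
  rcases le_total s s₀ with hss | hss
  · have h1 : Real.log (1 + κ * s * Real.log (1 + s) / c) ≤ κ * s * Real.log (1 + s) / c := by
      have := Real.log_le_sub_one_of_pos
        (show 0 < 1 + κ * s * Real.log (1 + s) / c by positivity)
      linarith
    calc _ ≤ c / Real.log (1 + s) * (κ * s * Real.log (1 + s) / c) := by gcongr
      _ = κ * s := by field_simp
      _ ≤ κ * s₀ := by gcongr
      _ = 1 / 2 := by rw [hs₀]; field_simp
  · have hls : Real.log (1 + s) ≤ s := by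
      have := Real.log_le_sub_one_of_pos (show 0 < 1 + s by linarith)
      linarith
    have h1 : Real.log (1 + κ * s * Real.log (1 + s) / c) ≤
        Real.log (1 + κ / c) + 2 * Real.log (1 + s) := by
      rw [show 2 * Real.log (1 + s) = Real.log ((1 + s) ^ 2) by rw [Real.log_pow]; norm_num,
        ← Real.log_mul (by positivity) (by positivity)]
      refine Real.log_le_log (by positivity) ?_
      have : s * Real.log (1 + s) ≤ s * s := by gcongr
      calc 1 + κ * s * Real.log (1 + s) / c = 1 + κ / c * (s * Real.log (1 + s)) := by ring
        _ ≤ 1 + κ / c * (s * s) := by gcongr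
        _ ≤ (1 + κ / c) * (1 + s) ^ 2 := by
          have : 0 < κ / c := by positivity
          nlinarith [mul_pos this hs]
    have h2 : Real.log (1 + κ / c) ≤ 2 * √(κ / c) := log_one_add_le_two_mul_sqrt (by positivity)
    have h3 : c * √(κ / c) ≤ ℓ / 8 := by
      rw [show c * √(κ / c) = √(c * κ) by
        rw [← Real.sqrt_sq hcpos.le, ← Real.sqrt_mul (by positivity), Real.sqrt_sq hcpos.le]
        congr 1; field_simp]
      rw [Real.sqrt_le_left (by positivity)]
      have : c ≤ ℓ ^ 2 / (64 * κ) := min_le_right _ _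
      rw [le_div_iff₀ (by positivity)] at this
      nlinarith
    have hℓs : ℓ ≤ Real.log (1 + s) := Real.log_le_log (by linarith) (by linarith)
    have hc8 : c ≤ 1 / 8 := min_le_left _ _
    calc _ ≤ c / Real.log (1 + s) * (2 * √(κ / c) + 2 * Real.log (1 + s)) := by
          gcongr; linarith
      _ = 2 * (c * √(κ / c)) / Real.log (1 + s) + 2 * c := by field_simp
      _ ≤ 2 * (ℓ / 8) / ℓ + 2 * (1 / 8) := by gcongr
      _ = 1 / 2 := by field_simp; norm_num

/-- Makes the additive `1` in Fano's inequality negligible. For small `K` the ratio `N / K` is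
large; for `K ≥ 12` already `K * log 2` exceeds `8`. -/
lemma eight_le_mul_log {K : ℕ} (hK : 1 ≤ K) (hKN : 2 * K < N) (hN : 12 * Real.exp 8 ≤ N) :
    8 ≤ K * Real.log (N / K) := by
  have hK1 : (1 : ℝ) ≤ K := by exact_mod_cast hK
  rcases le_total K 12 with h | h
  · have hK12 : (K : ℝ) ≤ 12 := by exact_mod_cast h
    have : 8 ≤ Real.log (N / K) := by
      rw [Real.le_log_iff_exp_le (div_pos (lt_of_lt_of_le (by positivity) hN) (by linarith)),
        le_div_iff₀ (by linarith)]
      nlinarith [Real.exp_pos 8]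
    nlinarith
  · have hK12 : (12 : ℝ) ≤ K := by exact_mod_cast h
    have : Real.log 2 ≤ Real.log (N / K) := by
      refine Real.log_le_log two_pos ?_
      rw [le_div_iff₀ (by linarith)]
      exact_mod_cast hKN.le
    nlinarith [Real.log_two_gt_d9]

/-- If there are fewer samples than a small multiple of `K log (N / K) / (R log (1 + σ²))`, every
decoder errs. -/
theorem half_le_errorProb_of_samples_lt {κ c : ℝ} (hκ : 0 < κ) (hc : 0 < c)
    (hcap : ∀ s : ℝ, 0 < s →
      c / Real.log (1 + s) * Real.log (1 + κ * s * Real.log (1 + s) / c) ≤ 1 / 2)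
    {K : ℕ} {snr : ℝ≥0} {ν : Measure ℝ} {σsq bmin : ℝ} (hN : 12 * Real.exp 8 ≤ N) (hK : 1 ≤ K)
    (hKN : 2 * K < N) (hRpos : 1 ≤ R) (hsnr : 0 < snr) (h : IsCoeffLaw ν σsq bmin)
    (hR : (R : ℝ) * snr ≤ κ * Real.log (N / K))
    (hT : (T : ℝ) < c * (singleComplexity N K σsq / R)) (dec : Decoder R T N) :
    1 / 2 ≤ errorProb K snr ν dec := by
  have := h.isProbabilityMeasure
  have hσ := h.variance_pos
  have hR0 : (0 : ℝ) < R := by exact_mod_cast hRpos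
  have hs : (0 : ℝ) < snr := by exact_mod_cast hsnr
  have hK0 : (0 : ℝ) < K := by exact_mod_cast hK
  set L := K * Real.log (N / K) with hL
  have hL8 : 8 ≤ L := eight_le_mul_log hK hKN hN
  have hchoose : L ≤ Real.log (N.choose K) := by
    have := Real.log_le_log (by
      have : (0 : ℝ) < N := by exact_mod_cast (by omega : 0 < N)
      positivity) (div_pow_le_choose hK (by omega : K ≤ N))
    rwa [Real.log_pow] at this
  have hlσ : 0 < Real.log (1 + σsq) := Real.log_pos (by linarith)
  have hcapacity : R * T / 2 * Real.log (1 + K * snr * σsq / T) ≤ L / 4 := by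
    rcases Nat.eq_zero_or_pos T with rfl | hTpos
    · simp only [Nat.cast_zero, mul_zero, zero_div, zero_mul]
      linarith
    have hT0 : (0 : ℝ) < T := by exact_mod_cast hTpos
    set u₀ := c * L / Real.log (1 + σsq) with hu₀
    have hu : (R * T : ℝ) ≤ u₀ := by
      have : (T : ℝ) < c * (L / Real.log (1 + σsq) / R) := hT
      have := mul_lt_mul_of_pos_left this hR0
      refine this.le.trans_eq ?_
      rw [hu₀]; field_simp
    have hu₀pos : 0 < u₀ := by positivity
    -- The SNR bound turns the argument into a function of `R * T` alone, so monotonicity in `u`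
    -- allows `u₀` in its place.
    have harg : K * snr * σsq / T ≤ κ * L * σsq / (R * T) := by
      rw [div_le_div_iff₀ hT0 (by positivity)]
      have : K * σsq * T * (R * snr) ≤ K * σsq * T * (κ * Real.log (N / K)) := by gcongr
      rw [hL]
      nlinarith
    have hlog : Real.log (1 + K * snr * σsq / T) ≤ Real.log (1 + κ * L * σsq / (R * T)) :=
      Real.log_le_log (by positivity) (by linarith)
    have h1 := mul_log_one_add_div_le (u := R * T) (by positivity) hu
      (show 0 ≤ κ * L * σsq by positivity)
    have h2 := hcap σsq hσ
    have e1 : κ * L * σsq / u₀ = κ * σsq * Real.log (1 + σsq) / c := by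
      rw [hu₀]; field_simp
    have e2 : u₀ = L * (c / Real.log (1 + σsq)) := by rw [hu₀]; ring
    rw [e1, e2, mul_assoc L] at h1
    have h3 : R * T * Real.log (1 + K * snr * σsq / T) ≤ L * (1 / 2) := calc
      _ ≤ R * T * Real.log (1 + κ * L * σsq / (R * T)) := by gcongr
      _ ≤ _ := h1
      _ ≤ L * (1 / 2) := by gcongr
    linarith
  have hfano := log_choose_mul_sum_successProb_le (by omega : K ≤ N) hsnr h dec
  have hc0 : (0 : ℝ) < N.choose K := by exact_mod_cast Nat.choose_pos (by omega)
  have hsucc : (N.choose K : ℝ)⁻¹ * ∑ S ∈ Finset.powersetCard K Finset.univ,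
      successProb snr ν dec S ≤ 1 / 2 := by
    rw [inv_mul_le_iff₀ hc0]
    refine le_of_mul_le_mul_left (hfano.trans ?_) (by linarith : 0 < Real.log (N.choose K))
    calc _ ≤ (N.choose K : ℝ) * (1 / 2 * Real.log (N.choose K)) := by gcongr; linarith
      _ = _ := by ring
  rw [errorProb_eq (by omega)]
  linarith

/-! ### Projections of Gaussian vectors and their chi-square moment generating functions. -/

section Projection

open scoped RealInnerProductSpace

lemma stdGaussian_map_orthogonalProjectionOnto {E : Type*} [NormedAddCommGroup E]
    [InnerProductSpace ℝ E] [FiniteDimensional ℝ E] [MeasurableSpace E] [BorelSpace E]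
    (V : Submodule ℝ E) :
    (stdGaussian E).map V.orthogonalProjectionOnto = stdGaussian V := by
  have hm : Measurable V.orthogonalProjectionOnto :=
    V.orthogonalProjectionOnto.continuous.measurable
  have : IsProbabilityMeasure ((stdGaussian E).map V.orthogonalProjectionOnto) :=
    Measure.isProbabilityMeasure_map hm.aemeasurable
  apply Measure.ext_of_charFun
  ext t
  have h : charFun ((stdGaussian E).map V.orthogonalProjectionOnto) t =
      charFun (stdGaussian E) (t : E) := by
    rw [charFun_apply, charFun_apply, integral_map hm.aemeasurable
      (Measurable.aestronglyMeasurable (by fun_prop))]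
    simp
  rw [h, charFun_stdGaussian, charFun_stdGaussian]
  simp

lemma integral_exp_mul_sq_gaussianReal {a : ℝ} (ha : 2 * a < 1) :
    ∫ x, Real.exp (a * x ^ 2) ∂gaussianReal 0 1 = (√(1 - 2 * a))⁻¹ := by
  rw [integral_gaussianReal_eq_integral_smul one_ne_zero]
  have h : ∀ x : ℝ, gaussianPDFReal 0 1 x • Real.exp (a * x ^ 2) =
      (√(2 * Real.pi))⁻¹ * Real.exp (-(1 / 2 - a) * x ^ 2) := fun x => by
    simp only [gaussianPDFReal, NNReal.coe_one, mul_one, sub_zero, smul_eq_mul]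
    rw [mul_assoc, ← Real.exp_add]
    ring_nf
  simp only [h]
  rw [integral_const_mul, integral_gaussian, ← Real.sqrt_inv, ← Real.sqrt_inv,
    ← Real.sqrt_mul (by positivity)]
  congr 1
  have : 1 - 2 * a ≠ 0 := by linarith
  have : 1 / 2 - a ≠ 0 := by linarith
  have := Real.pi_ne_zero
  field_simp

lemma integral_exp_mul_norm_sq_stdGaussian {E : Type*} [NormedAddCommGroup E]
    [InnerProductSpace ℝ E] [FiniteDimensional ℝ E] [MeasurableSpace E] [BorelSpace E]
    {a : ℝ} (ha : 2 * a < 1) :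
    ∫ x, Real.exp (a * ‖x‖ ^ 2) ∂stdGaussian E = (√(1 - 2 * a))⁻¹ ^ Module.finrank ℝ E := by
  rw [stdGaussian, integral_map (Measurable.aemeasurable (by fun_prop))
    (Measurable.aestronglyMeasurable (by fun_prop))]
  have h : ∀ x : Fin (Module.finrank ℝ E) → ℝ,
      Real.exp (a * ‖∑ i, x i • stdOrthonormalBasis ℝ E i‖ ^ 2) =
        ∏ i, Real.exp (a * x i ^ 2) := fun x => by
    rw [← Real.exp_sum, ← Finset.mul_sum, ← real_inner_self_eq_norm_sq,
      (stdOrthonormalBasis ℝ E).orthonormal.inner_sum]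
    simp [pow_two]
  simp only [h]
  rw [integral_fintype_prod_eq_prod (f := fun _ x => Real.exp (a * x ^ 2))]
  simp [integral_exp_mul_sq_gaussianReal ha]

lemma pi_gaussianReal_eq_map {ι : Type*} [Fintype ι] (v : ℝ≥0) :
    (Measure.pi fun _ : ι => gaussianReal 0 v) =
      (Measure.pi fun _ : ι => gaussianReal 0 1).map fun x i => √v * x i := by
  rw [Measure.pi_map_pi (f := fun _ x => √v * x) fun i => Measurable.aemeasurable (by fun_prop)]
  congr 1 with i : 1
  rw [gaussianReal_map_const_mul]
  congr 1
  · simp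
  · ext
    simp

/-- The moment generating function of the squared norm of a projected Gaussian vector. -/
lemma integral_exp_mul_norm_sq_projection {ι : Type*} [Fintype ι] (v : ℝ≥0)
    (V : Submodule ℝ (EuclideanSpace ℝ ι)) {a : ℝ} (ha : 2 * (a * v) < 1) :
    ∫ w, Real.exp (a * ‖V.starProjection (WithLp.toLp 2 w)‖ ^ 2)
        ∂(Measure.pi fun _ : ι => gaussianReal 0 v) =
      (√(1 - 2 * (a * v)))⁻¹ ^ Module.finrank ℝ V := by
  have hm : Measurable V.orthogonalProjectionOnto :=
    V.orthogonalProjectionOnto.continuous.measurable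
  have hm' : Measurable V.starProjection := V.starProjection.continuous.measurable
  rw [← integral_exp_mul_norm_sq_stdGaussian ha, ← stdGaussian_map_orthogonalProjectionOnto V,
    ← map_pi_eq_stdGaussian, integral_map hm.aemeasurable
      (Measurable.aestronglyMeasurable (by fun_prop)),
    integral_map (Measurable.aemeasurable (by fun_prop))
      (Measurable.aestronglyMeasurable (by fun_prop)),
    pi_gaussianReal_eq_map, integral_map (Measurable.aemeasurable (by fun_prop))
      (Measurable.aestronglyMeasurable (by fun_prop))]
  congr 1 with w
  have : WithLp.toLp 2 (fun i => √(v : ℝ) * w i) = √(v : ℝ) • WithLp.toLp 2 w := by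
    ext i; simp
  rw [this, map_smul, norm_smul, mul_pow, Real.norm_eq_abs, sq_abs, Real.sq_sqrt v.coe_nonneg,
    Submodule.starProjection_apply, Submodule.coe_norm, mul_assoc]

lemma integrable_exp_mul_norm_sq_projection {ι : Type*} [Fintype ι] (v : ℝ≥0)
    (V : Submodule ℝ (EuclideanSpace ℝ ι)) {a : ℝ} (ha : 2 * (a * v) < 1) :
    Integrable (fun w => Real.exp (a * ‖V.starProjection (WithLp.toLp 2 w)‖ ^ 2))
      (Measure.pi fun _ : ι => gaussianReal 0 v) := by
  by_contra h
  have h1 := integral_exp_mul_norm_sq_projection v V ha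
  rw [integral_undef h] at h1
  have : 0 < √(1 - 2 * (a * v)) := Real.sqrt_pos.2 (by linarith)
  have : 0 < (√(1 - 2 * (a * v)))⁻¹ ^ Module.finrank ℝ V := by positivity
  linarith

end Projection

/-! ### Residuals of least squares. -/

section LeastSquares

/-- The residual sum of squares when `y` is regressed on the columns of `x` indexed by `S`. -/
noncomputable def residual (S : Finset (Fin N)) (x : Fin T → Fin N → ℝ) (y : Fin T → ℝ) : ℝ :=
  ⨅ β : Fin N → ℝ, ∑ t, (y t - ∑ n ∈ S, x t n * β n) ^ 2

/-- The span of the columns of `x` indexed by `S`. -/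
noncomputable def columnSpan (S : Finset (Fin N)) (x : Fin T → Fin N → ℝ) :
    Submodule ℝ (EuclideanSpace ℝ (Fin T)) :=
  Submodule.span ℝ ((fun n => WithLp.toLp 2 fun t => x t n) '' (S : Set (Fin N)))

lemma bddBelow_residual (S : Finset (Fin N)) (x : Fin T → Fin N → ℝ) (y : Fin T → ℝ) :
    BddBelow (Set.range fun β : Fin N → ℝ => ∑ t, (y t - ∑ n ∈ S, x t n * β n) ^ 2) :=
  ⟨0, by rintro _ ⟨β, rfl⟩; exact Finset.sum_nonneg fun t _ => sq_nonneg _⟩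

lemma residual_nonneg (S : Finset (Fin N)) (x : Fin T → Fin N → ℝ) (y : Fin T → ℝ) :
    0 ≤ residual S x y :=
  Real.iInf_nonneg fun _ => Finset.sum_nonneg fun _ _ => sq_nonneg _

/-- The reason for defining `residual` as an infimum: an infimum of continuous functions is upper
semicontinuous jointly in design and outcome, whereas the column span varies irregularly with the
design. -/
lemma measurable_residual (S : Finset (Fin N)) :
    Measurable fun p : (Fin T → Fin N → ℝ) × (Fin T → ℝ) => residual S p.1 p.2 := by
  refine UpperSemicontinuous.measurable (upperSemicontinuous_ciInf
    (fun p => bddBelow_residual S p.1 p.2) fun β => Continuous.upperSemicontinuous ?_)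
  fun_prop

lemma residual_le (S : Finset (Fin N)) (x : Fin T → Fin N → ℝ) (β : Fin N → ℝ) (w : Fin T → ℝ) :
    residual S x (fun t => ∑ n ∈ S, x t n * β n + w t) ≤ ∑ t, w t ^ 2 := by
  refine (ciInf_le (bddBelow_residual S x _) β).trans_eq ?_
  simp

lemma mem_columnSpan_iff {S : Finset (Fin N)} {x : Fin T → Fin N → ℝ}
    {z : EuclideanSpace ℝ (Fin T)} :
    z ∈ columnSpan S x ↔ ∃ β : Fin N → ℝ, z = WithLp.toLp 2 fun t => ∑ n ∈ S, x t n * β n := by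
  rw [columnSpan, Submodule.mem_span_image_finset_iff_exists_fun']
  refine exists_congr fun β => ?_
  have : ∑ n ∈ S, β n • (WithLp.toLp 2 fun t => x t n : EuclideanSpace ℝ (Fin T)) =
      WithLp.toLp 2 fun t => ∑ n ∈ S, x t n * β n := by
    ext t
    simp [mul_comm]
  rw [this, eq_comm]

lemma finrank_columnSpan_le (S : Finset (Fin N)) (x : Fin T → Fin N → ℝ) :
    Module.finrank ℝ (columnSpan S x) ≤ S.card := by
  classical
  have h := finrank_span_finset_le_card (R := ℝ)
    (S.image fun n => (WithLp.toLp 2 fun t => x t n : EuclideanSpace ℝ (Fin T)))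
  rw [Set.finrank, Finset.coe_image] at h
  exact h.trans Finset.card_image_le

lemma residual_eq_norm_sq (S : Finset (Fin N)) (x : Fin T → Fin N → ℝ) (y : Fin T → ℝ) :
    residual S x y = ‖(columnSpan S x)ᗮ.starProjection (WithLp.toLp 2 y)‖ ^ 2 := by
  set V := columnSpan S x
  have hperp : (V)ᗮ.starProjection (WithLp.toLp 2 y) =
      WithLp.toLp 2 y - V.starProjection (WithLp.toLp 2 y) :=
    V.starProjection_orthogonal_val _
  have hsum : ∀ β : Fin N → ℝ, ∑ t, (y t - ∑ n ∈ S, x t n * β n) ^ 2 =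
      ‖WithLp.toLp 2 y - WithLp.toLp 2 fun t => ∑ n ∈ S, x t n * β n‖ ^ 2 := fun β => by
    rw [EuclideanSpace.real_norm_sq_eq]
    simp
  rw [hperp]
  refine le_antisymm ?_ ?_
  · obtain ⟨β, hβ⟩ := mem_columnSpan_iff.1 (V.starProjection_apply_mem (WithLp.toLp 2 y))
    rw [hβ, ← hsum]
    exact ciInf_le (bddBelow_residual S x y) β
  · refine le_ciInf fun β => ?_
    rw [hsum]
    gcongr
    rw [V.starProjection_minimal]
    exact ciInf_le ⟨0, by rintro _ ⟨z, rfl⟩; exact norm_nonneg _⟩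
      (⟨_, mem_columnSpan_iff.2 ⟨β, rfl⟩⟩ : V)

open scoped RealInnerProductSpace in
-- Splits the noise contribution to a wrong fit into a linear Gaussian term and a chi-square term of
-- rank at most `S.card`; the total noise energy cancels against the residual of the true support.
lemma residual_add (S : Finset (Fin N)) (x : Fin T → Fin N → ℝ) (m w : Fin T → ℝ) :
    residual S x (fun t => m t + w t) = residual S x m + ∑ t, w t ^ 2 +
      2 * ∑ t, (columnSpan S x)ᗮ.starProjection (WithLp.toLp 2 m) t * w t -
      ‖(columnSpan S x).starProjection (WithLp.toLp 2 w)‖ ^ 2 := by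
  set V := columnSpan S x
  set a := (V)ᗮ.starProjection (WithLp.toLp 2 m) with ha
  have hadd : WithLp.toLp 2 (fun t => m t + w t) = WithLp.toLp 2 m + WithLp.toLp 2 w := rfl
  have hw := V.norm_sq_eq_add_norm_sq_starProjection (WithLp.toLp 2 w)
  rw [EuclideanSpace.real_norm_sq_eq] at hw
  have hin : ⟪a, (V)ᗮ.starProjection (WithLp.toLp 2 w)⟫ = ∑ t, a t * w t := by
    have : ⟪a, WithLp.toLp 2 w⟫ = ⟪a, (V)ᗮ.starProjection (WithLp.toLp 2 w)⟫ := by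
      rw [ha, ← Submodule.inner_starProjection_left_eq_right,
        Submodule.starProjection_eq_self_iff.2 (Submodule.starProjection_apply_mem _ _)]
    rw [← this]
    simp [PiLp.inner_apply, mul_comm]
  rw [residual_eq_norm_sq, residual_eq_norm_sq, hadd, map_add, norm_add_sq_real, hin]
  simp only at hw
  linarith

end LeastSquares

/-! ### Confusion of two supports for a fixed design. -/

lemma integral_exp_sum_mul_noise {snr : ℝ≥0} (a : Fin R → Fin T → ℝ) :
    ∫ W, Real.exp (∑ r, ∑ t, a r t * W r t) ∂(noiseLaw R T snr) =
      Real.exp ((snr : ℝ)⁻¹ / 2 * ∑ r, ∑ t, a r t ^ 2) := by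
  have h1 : ∀ c : ℝ, ∫ x, Real.exp (c * x) ∂gaussianReal 0 snr⁻¹ =
      Real.exp ((snr : ℝ)⁻¹ / 2 * c ^ 2) := fun c => by
    have := congrFun (mgf_fun_id_gaussianReal (μ := 0) (v := snr⁻¹)) c
    rw [mgf] at this
    rw [this]
    simp only [zero_mul, zero_add, NNReal.coe_inv]
    ring_nf
  simp only [Real.exp_sum, noiseLaw]
  rw [integral_fintype_prod_eq_prod (f := fun r (w : Fin T → ℝ) => ∏ t, Real.exp (a r t * w t))]
  have h2 : ∀ r, ∫ w : Fin T → ℝ, ∏ t, Real.exp (a r t * w t)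
      ∂(Measure.pi fun _ => gaussianReal 0 snr⁻¹) =
        Real.exp ((snr : ℝ)⁻¹ / 2 * ∑ t, a r t ^ 2) := fun r => by
    rw [integral_fintype_prod_eq_prod (f := fun t (w : ℝ) => Real.exp (a r t * w))]
    simp_rw [h1, ← Real.exp_sum, ← Finset.mul_sum]
  simp_rw [h2, ← Real.exp_sum, ← Finset.mul_sum]

lemma integrable_exp_sum_mul_noise {snr : ℝ≥0} (a : Fin R → Fin T → ℝ) :
    Integrable (fun W => Real.exp (∑ r, ∑ t, a r t * W r t)) (noiseLaw R T snr) := by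
  by_contra h
  have h1 := integral_exp_sum_mul_noise (snr := snr) a
  rw [integral_undef h] at h1
  exact (Real.exp_pos _).ne h1

lemma integral_exp_sum_projection_noise_le {snr : ℝ≥0} (hsnr : 0 < snr) {K : ℕ}
    (V : Fin R → Submodule ℝ (EuclideanSpace ℝ (Fin T)))
    (hV : ∀ r, Module.finrank ℝ (V r) ≤ K) :
    Integrable (fun W : Outcome R T => Real.exp (∑ r, snr / 4 *
      ‖(V r).starProjection (WithLp.toLp 2 (W r))‖ ^ 2)) (noiseLaw R T snr) ∧
    ∫ W, Real.exp (∑ r, snr / 4 * ‖(V r).starProjection (WithLp.toLp 2 (W r))‖ ^ 2)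
      ∂(noiseLaw R T snr) ≤ 2 ^ (K * R) := by
  have hs : (snr : ℝ) ≠ 0 := by exact_mod_cast hsnr.ne'
  -- Each dimension contributes a factor `(1 - 2 / 4) ^ (-1 / 2) = √2`, rounded up to `2`.
  have ha : (snr / 4 : ℝ) * (snr⁻¹ : ℝ≥0) = 1 / 4 := by
    rw [NNReal.coe_inv]; field_simp
  have ha' : 2 * ((snr / 4 : ℝ) * (snr⁻¹ : ℝ≥0)) < 1 := by rw [ha]; norm_num
  simp only [Real.exp_sum, noiseLaw]
  constructor
  · exact Integrable.fintype_prod_dep (f := fun r (w : Fin T → ℝ) => Real.exp (snr / 4 *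
      ‖(V r).starProjection (WithLp.toLp 2 w)‖ ^ 2))
      fun r => integrable_exp_mul_norm_sq_projection _ (V r) ha'
  · rw [integral_fintype_prod_eq_prod (f := fun r (w : Fin T → ℝ) => Real.exp (snr / 4 *
      ‖(V r).starProjection (WithLp.toLp 2 w)‖ ^ 2))]
    simp_rw [integral_exp_mul_norm_sq_projection _ (V _) ha', ha]
    have h2 : (√(1 - 2 * (1 / 4) : ℝ))⁻¹ ≤ 2 := by
      rw [inv_le_comm₀ (Real.sqrt_pos.2 (by norm_num)) two_pos]
      exact Real.le_sqrt_of_sq_le (by norm_num)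
    calc ∏ r, (√(1 - 2 * (1 / 4) : ℝ))⁻¹ ^ Module.finrank ℝ (V r)
        ≤ ∏ _r : Fin R, (2 : ℝ) ^ K := by
          refine Finset.prod_le_prod (fun r _ => by positivity) fun r _ => ?_
          calc _ ≤ (2 : ℝ) ^ Module.finrank ℝ (V r) := by gcongr
            _ ≤ _ := pow_le_pow_right₀ (by norm_num) (hV r)
      _ = 2 ^ (K * R) := by simp [pow_mul]

/-- The probability, for given design and coefficients, that the true support `S` does not fit
better than `S'`. -/
lemma noiseLaw_residual_le {snr : ℝ≥0} (hsnr : 0 < snr) (S S' : Finset (Fin N))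
    (X : Design R T N) (γ : Coeff R N) :
    (noiseLaw R T snr).real {W | ∑ r, residual S' (X r) (outcome S X γ W r) ≤
      ∑ r, residual S (X r) (outcome S X γ W r)} ≤
    (1 + 2 ^ (S'.card * R)) * ∏ r, Real.exp (-(snr / 32) *
      residual S' (X r) (signal S X γ r)) := by
  have hs : (0 : ℝ) < snr := by exact_mod_cast hsnr
  set A := ∑ r, residual S' (X r) (signal S X γ r) with hA
  have hA0 : 0 ≤ A := Finset.sum_nonneg fun r _ => residual_nonneg _ _ _
  set V := fun r => columnSpan S' (X r) with hV
  set a : Fin R → EuclideanSpace ℝ (Fin T) := fun r =>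
    (V r)ᗮ.starProjection (WithLp.toLp 2 (signal S X γ r)) with ha
  have haA : ∑ r, ∑ t, a r t ^ 2 = A := by
    refine Finset.sum_congr rfl fun r _ => ?_
    rw [residual_eq_norm_sq, EuclideanSpace.real_norm_sq_eq]
  have hout : ∀ W r, outcome S X γ W r = fun t => signal S X γ r t + W r t := fun W r => by
    rw [outcome_eq_signal_add]
  set B := {W | ∑ r, residual S' (X r) (outcome S X γ W r) ≤
      ∑ r, residual S (X r) (outcome S X γ W r)} with hB
  have hBm : MeasurableSet B := by
    have hm : ∀ S'' r, Measurable fun W : Outcome R T =>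
        residual S'' (X r) (outcome S X γ W r) := fun S'' r => by
      simp only [hout]
      exact (measurable_residual S'').comp (g := fun p : (Fin T → Fin N → ℝ) × (Fin T → ℝ) =>
        residual S'' p.1 p.2) (f := fun W : Outcome R T => (X r, fun t => signal S X γ r t + W r t))
        (by fun_prop)
    exact measurableSet_le (Finset.measurable_sum _ fun r _ => hm S' r)
      (Finset.measurable_sum _ fun r _ => hm S r)
  -- Chernoff bounds for the two ways the signal energy `A` can be overcome. The tilt `snr / 4`
  -- gives `f₁` the mean `exp (-snr * A / 16 + snr * A / 32)`, the source of `snr / 32`.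
  set f₁ : Outcome R T → ℝ := fun W =>
    Real.exp (-(snr * A / 16)) * Real.exp (∑ r, ∑ t, -(snr / 4) * a r t * W r t) with hf₁
  set f₂ : Outcome R T → ℝ := fun W => Real.exp (-(snr * A / 8)) *
    Real.exp (∑ r, snr / 4 * ‖(V r).starProjection (WithLp.toLp 2 (W r))‖ ^ 2) with hf₂
  obtain ⟨hi₂, hb₂⟩ := integral_exp_sum_projection_noise_le hsnr V
    fun r => finrank_columnSpan_le S' (X r)
  have hi₁ := integrable_exp_sum_mul_noise (snr := snr) fun r t => -(snr / 4) * a r t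
  have hpt : ∀ W, B.indicator 1 W ≤ f₁ W + f₂ W := by
    intro W
    by_cases hW : W ∈ B
    · rw [Set.indicator_of_mem hW, Pi.one_apply]
      have hle : ∑ r, residual S' (X r) (outcome S X γ W r) ≤ ∑ r, ∑ t, W r t ^ 2 := by
        refine le_trans hW (Finset.sum_le_sum fun r _ => ?_)
        rw [hout]
        exact residual_le S (X r) (γ r) (W r)
      have heq : ∑ r, residual S' (X r) (outcome S X γ W r) = A + ∑ r, ∑ t, W r t ^ 2 +
          2 * ∑ r, ∑ t, a r t * W r t -
          ∑ r, ‖(V r).starProjection (WithLp.toLp 2 (W r))‖ ^ 2 := by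
        rw [Finset.mul_sum, ← Finset.sum_add_distrib, ← Finset.sum_add_distrib,
          ← Finset.sum_sub_distrib]
        refine Finset.sum_congr rfl fun r _ => ?_
        rw [hout, residual_add]
      have hlin : ∑ r, ∑ t, -(snr / 4) * a r t * W r t =
          -(snr / 4) * ∑ r, ∑ t, a r t * W r t := by
        simp only [Finset.mul_sum, mul_assoc]
      rw [heq] at hle
      -- On `B`, `A + 2 * ∑ a * W ≤ ∑ ‖P W‖ ^ 2`; if both alternatives failed, the left side would
      -- exceed `A / 2` and the right side would be smaller.
      have hcase : A / 4 ≤ -∑ r, ∑ t, a r t * W r t ∨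
          A / 2 ≤ ∑ r, ‖(V r).starProjection (WithLp.toLp 2 (W r))‖ ^ 2 := by
        by_contra! hcon
        linarith
      rcases hcase with h | h
      · have h1 : 1 ≤ f₁ W := by
          simp only [hf₁]
          rw [← Real.exp_add, hlin]
          refine Real.one_le_exp ?_
          nlinarith
        have h2 : 0 ≤ f₂ W := by positivity
        linarith
      · have h1 : 1 ≤ f₂ W := by
          simp only [hf₂]
          rw [← Real.exp_add, ← Finset.mul_sum]
          refine Real.one_le_exp ?_
          nlinarith
        have h2 : 0 ≤ f₁ W := by positivity
        linarith
    · rw [Set.indicator_of_notMem hW]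
      positivity
  have hint := integral_mono (μ := noiseLaw R T snr) ((integrable_const (1 : ℝ)).indicator hBm)
    ((hi₁.const_mul _).add (hi₂.const_mul _)) hpt
  rw [show (fun _ : Outcome R T => (1 : ℝ)) = 1 from rfl, integral_indicator_one hBm] at hint
  refine hint.trans ?_
  have hadd := integral_add (hi₁.const_mul (Real.exp (-(snr * A / 16))))
    (hi₂.const_mul (Real.exp (-(snr * A / 8))))
  rw [← Real.exp_sum, ← Finset.mul_sum, ← hA]
  refine hadd.trans_le ?_
  rw [integral_const_mul, integral_const_mul, integral_exp_sum_mul_noise]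
  have e1 : ∑ r, ∑ t, (-(snr / 4) * a r t) ^ 2 = (snr / 4 : ℝ) ^ 2 * A := by
    simp only [← haA, Finset.mul_sum]
    refine Finset.sum_congr rfl fun r _ => Finset.sum_congr rfl fun t _ => by ring
  rw [e1, ← Real.exp_add, show -(snr * A / 16) + (snr : ℝ)⁻¹ / 2 * ((snr / 4) ^ 2 * A) =
    -(snr / 32) * A by field_simp; ring]
  have e2 : Real.exp (-(snr * A / 8)) ≤ Real.exp (-(snr / 32) * A) :=
    Real.exp_le_exp.2 (by nlinarith [mul_nonneg hs.le hA0])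
  rw [add_mul, one_mul, mul_comm ((2 : ℝ) ^ (S'.card * R))]
  gcongr

/-! ### Averaging the confusion bound over the design. -/

lemma residual_sum_eq_residual_sdiff (S S' : Finset (Fin N)) (x : Fin T → Fin N → ℝ)
    (c : Fin N → ℝ) : residual S' x (fun t => ∑ n ∈ S, x t n * c n) =
      residual S' x (fun t => ∑ n ∈ S \ S', x t n * c n) := by
  rw [residual_eq_norm_sq, residual_eq_norm_sq]
  have h : (WithLp.toLp 2 fun t => ∑ n ∈ S, x t n * c n : EuclideanSpace ℝ (Fin T)) =
      (WithLp.toLp 2 fun t => ∑ n ∈ S', x t n * (if n ∈ S then c n else 0)) +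
        WithLp.toLp 2 fun t => ∑ n ∈ S \ S', x t n * c n := by
    ext t
    have : ∑ n ∈ S', x t n * (if n ∈ S then c n else 0) = ∑ n ∈ S ∩ S', x t n * c n := by
      rw [Finset.inter_comm, ← Finset.sum_ite_mem]
      simp
    simp only [PiLp.add_apply]
    rw [this, Finset.sum_inter_add_sum_sdiff]
  rw [h, map_add, Submodule.starProjection_orthogonal_apply_eq_zero
    (mem_columnSpan_iff.2 ⟨_, rfl⟩), zero_add]

lemma residual_congr {S : Finset (Fin N)} {x x' : Fin T → Fin N → ℝ}
    (h : ∀ t, ∀ n ∈ S, x t n = x' t n) (y : Fin T → ℝ) : residual S x y = residual S x' y := by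
  simp only [residual]
  congr 1 with β
  refine Finset.sum_congr rfl fun t _ => ?_
  rw [Finset.sum_congr rfl fun n hn => by rw [h t n hn]]

lemma pi_gaussianReal_map_sum (v : ℝ≥0) (c : Fin N → ℝ) :
    (Measure.pi fun _ : Fin N => gaussianReal 0 v).map (fun x => ∑ n, x n * c n) =
      gaussianReal 0 (v * ∑ n, ‖c n‖₊ ^ 2) := by
  have h1 : (Measure.pi fun _ : Fin N => gaussianReal 0 v).map (fun x n => x n * c n) =
      Measure.pi fun n => gaussianReal 0 (‖c n‖₊ ^ 2 * v) := by
    rw [Measure.pi_map_pi (f := fun n x => x * c n) fun n => Measurable.aemeasurable (by fun_prop)]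
    congr 1 with n : 1
    rw [gaussianReal_map_mul_const]
    congr 1
    · simp
    · ext; simp
  have h2 : (fun x : Fin N → ℝ => ∑ n, x n * c n) =
      (fun p : Fin N → ℝ => ∑ n, p n) ∘ fun x n => x n * c n := rfl
  rw [h2, ← Measure.map_map (by fun_prop) (by fun_prop), h1]
  have : IsProbabilityMeasure ((Measure.pi fun n => gaussianReal 0 (‖c n‖₊ ^ 2 * v)).map
      fun p : Fin N → ℝ => ∑ n, p n) :=
    Measure.isProbabilityMeasure_map (Measurable.aemeasurable (by fun_prop))
  apply Measure.ext_of_charFun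
  rw [charFun_map_sum_pi_eq_prod]
  ext t
  simp only [Finset.prod_apply, charFun_gaussianReal, ← Complex.exp_sum]
  congr 1
  push_cast
  simp only [mul_zero, zero_mul, zero_sub, Finset.sum_neg_distrib, Finset.mul_sum,
    Finset.sum_mul, Finset.sum_div]
  congr 1
  exact Finset.sum_congr rfl fun n _ => by ring

/-- In a Gaussian row, the entries in `S'` are independent of linear combinations of the others. -/
lemma pi_gaussianReal_map_prodMk (v : ℝ≥0) (S' A : Finset (Fin N)) (hA : Disjoint S' A)
    (c : Fin N → ℝ) :
    (Measure.pi fun _ : Fin N => gaussianReal 0 v).map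
      (fun x => ((fun n => if n ∈ S' then x n else 0 : Fin N → ℝ), ∑ n ∈ A, x n * c n)) =
    ((Measure.pi fun _ : Fin N => gaussianReal 0 v).map
      (fun x => (fun n => if n ∈ S' then x n else 0 : Fin N → ℝ))).prod
      (gaussianReal 0 (v * ∑ n ∈ A, ‖c n‖₊ ^ 2)) := by
  set ρ := Measure.pi fun _ : Fin N => gaussianReal 0 v with hρ
  have hind : iIndepFun (fun (n : Fin N) (x : Fin N → ℝ) => x n) ρ :=
    iIndepFun_pi (X := fun _ x => x) fun _ => aemeasurable_id
  have h0 := hind.indepFun_finset S' A hA fun n => measurable_pi_apply n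
  set g₁ : (S' → ℝ) → Fin N → ℝ := fun z n => if h : n ∈ S' then z ⟨n, h⟩ else 0 with hg₁
  set g₂ : (A → ℝ) → ℝ := fun z => ∑ n : A, z n * c n with hg₂
  have hg₁m : Measurable g₁ := by
    refine measurable_pi_lambda _ fun n => ?_
    by_cases h : n ∈ S'
    · simp only [hg₁, h, dif_pos]; fun_prop
    · simp only [hg₁, h, dif_neg, not_false_eq_true]; fun_prop
  have h1 := h0.comp hg₁m (show Measurable g₂ by fun_prop)
  have e1 : (g₁ ∘ fun (x : Fin N → ℝ) (i : S') => x i) =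
      fun x n => if n ∈ S' then x n else 0 := by
    ext x n
    simp [hg₁]
  have e2 : (g₂ ∘ fun (x : Fin N → ℝ) (i : A) => x i) = fun x => ∑ n ∈ A, x n * c n := by
    ext x
    simp only [hg₂, Function.comp]
    exact Finset.sum_coe_sort A fun n => x n * c n
  rw [e1, e2, indepFun_iff_map_prod_eq_prod_map_map
    (Measurable.aemeasurable (by
      refine measurable_pi_lambda _ fun n => ?_
      by_cases h : n ∈ S'
      · simp only [h, if_true]; fun_prop
      · simp only [h, if_false]; fun_prop))
    (Measurable.aemeasurable (by fun_prop))] at h1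
  rw [h1]
  congr 1
  have h2 := pi_gaussianReal_map_sum v fun n => if n ∈ A then c n else 0
  have e3 : (fun x : Fin N → ℝ => ∑ n, x n * if n ∈ A then c n else 0) =
      fun x => ∑ n ∈ A, x n * c n := by
    ext x
    simp [Finset.sum_ite_mem]
  have e4 : ∑ n, ‖if n ∈ A then c n else 0‖₊ ^ 2 = ∑ n ∈ A, ‖c n‖₊ ^ 2 := by
    rw [← Finset.sum_filter_add_sum_filter_not Finset.univ (· ∈ A)]
    rw [Finset.sum_congr rfl (g := fun n => ‖c n‖₊ ^ 2) fun n hn => by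
      rw [if_pos (Finset.mem_filter.1 hn).2],
      Finset.sum_eq_zero (s := Finset.univ.filter (· ∉ A)) fun n hn => by
      rw [if_neg (Finset.mem_filter.1 hn).2]; simp]
    simp
  rw [e3, e4] at h2
  exact h2

/-- The residual of a signal outside the fitted support is rarely small. -/
lemma integral_exp_neg_residual_le {lam b : ℝ} (hlam : 0 ≤ lam) (hb : 0 < b)
    (S S' : Finset (Fin N)) {c : Fin N → ℝ} (hc : ∀ n, b ≤ |c n|) :
    ∫ x, Real.exp (-lam * residual S' x fun t => ∑ n ∈ S, x t n * c n)
      ∂(Measure.pi fun _ : Fin T => Measure.pi fun _ : Fin N => gaussianReal 0 (T : ℝ≥0)⁻¹) ≤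
    (√(1 + 2 * (lam * ((S \ S').card * b ^ 2 / T))))⁻¹ ^ (T - S'.card) := by
  set v : ℝ≥0 := (T : ℝ≥0)⁻¹ with hv
  set ρ := Measure.pi fun _ : Fin N => gaussianReal 0 v with hρ
  set A := S \ S' with hA
  set φ : (Fin N → ℝ) → (Fin N → ℝ) × ℝ :=
    fun x => ((fun n => if n ∈ S' then x n else 0 : Fin N → ℝ), ∑ n ∈ A, x n * c n) with hφ
  set ρ₁ := ρ.map (fun x => (fun n => if n ∈ S' then x n else 0 : Fin N → ℝ)) with hρ₁
  set u : ℝ≥0 := v * ∑ n ∈ A, ‖c n‖₊ ^ 2 with hu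
  have hm₁ : Measurable
      (fun (x : Fin N → ℝ) => (fun n => if n ∈ S' then x n else 0 : Fin N → ℝ)) := by
    refine measurable_pi_lambda _ fun n => ?_
    by_cases h : n ∈ S'
    · simp only [h, if_true]; fun_prop
    · simp only [h, if_false]; fun_prop
  have hφm : Measurable φ := hm₁.prodMk (by fun_prop)
  have : IsProbabilityMeasure ρ₁ := Measure.isProbabilityMeasure_map hm₁.aemeasurable
  have hrow : ρ.map φ = ρ₁.prod (gaussianReal 0 u) :=
    pi_gaussianReal_map_prodMk v S' A Finset.disjoint_sdiff c
  set H : (Fin T → Fin N → ℝ) × (Fin T → ℝ) → ℝ := fun p =>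
    Real.exp (-lam * residual S' p.1 p.2) with hH
  have hHm : Measurable H := ((measurable_residual S').const_mul _).exp
  have hHb : ∀ p, |H p| ≤ 1 := fun p => by
    rw [abs_of_pos (Real.exp_pos _)]
    refine Real.exp_le_one_iff.2 ?_
    nlinarith [residual_nonneg S' p.1 p.2]
  -- Regroups the independent rows into the fitted columns and an independent Gaussian signal, so
  -- that the column span can be frozen while the signal is integrated.
  have hpres : MeasurePreserving (fun x : Fin T → Fin N → ℝ =>
      MeasurableEquiv.arrowProdEquivProdArrow (Fin N → ℝ) ℝ (Fin T) fun t => φ (x t))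
      (Measure.pi fun _ : Fin T => ρ)
      ((Measure.pi fun _ : Fin T => ρ₁).prod (Measure.pi fun _ : Fin T => gaussianReal 0 u)) := by
    refine (measurePreserving_arrowProdEquivProdArrow (Fin N → ℝ) ℝ (Fin T) (fun _ => ρ₁)
      fun _ => gaussianReal 0 u).comp ⟨by fun_prop, ?_⟩
    have : ∀ _ : Fin T, SigmaFinite (ρ.map φ) := fun _ => by rw [hrow]; infer_instance
    rw [Measure.pi_map_pi (f := fun (_ : Fin T) x => φ x) fun _ => hφm.aemeasurable, hrow]
  have hfun : ∀ x : Fin T → Fin N → ℝ,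
      Real.exp (-lam * residual S' x fun t => ∑ n ∈ S, x t n * c n) =
      H (MeasurableEquiv.arrowProdEquivProdArrow (Fin N → ℝ) ℝ (Fin T) fun t => φ (x t)) := by
    intro x
    rw [residual_sum_eq_residual_sdiff]
    simp only [hH]
    congr 2
    exact residual_congr (fun t n hn => by
      simp [MeasurableEquiv.arrowProdEquivProdArrow, Equiv.arrowProdEquivProdArrow, hφ, hn]) _
  simp only [hfun]
  rw [integral_comp_measurePreserving hpres hHm, integral_prod _ (integrable_of_abs_le hHm hHb)]
  have hu_ge : (S \ S').card * b ^ 2 / T ≤ (u : ℝ) := by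
    have : ((S \ S').card : ℝ) * b ^ 2 ≤ ∑ n ∈ A, |c n| ^ 2 := by
      rw [← nsmul_eq_mul]
      exact Finset.card_nsmul_le_sum _ _ _ fun n _ => pow_le_pow_left₀ hb.le (hc n) 2
    rw [hu, hv]
    push_cast
    rw [div_eq_inv_mul]
    simp only [Real.norm_eq_abs]
    gcongr
  have hinner : ∀ z : Fin T → Fin N → ℝ, ∫ g, H (z, g) ∂(Measure.pi fun _ : Fin T =>
      gaussianReal 0 u) ≤ (√(1 + 2 * (lam * ((S \ S').card * b ^ 2 / T))))⁻¹ ^ (T - S'.card) := by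
    intro z
    simp only [hH, residual_eq_norm_sq]
    rw [integral_exp_mul_norm_sq_projection u _ (a := -lam) (by
      nlinarith [mul_nonneg hlam u.coe_nonneg])]
    -- Truncated subtraction is harmless: for `T ≤ S'.card` the exponent is `0` and the bound is
    -- `1`.
    have hrank : T - S'.card ≤ Module.finrank ℝ (columnSpan S' z)ᗮ := by
      have h1 := (columnSpan S' z).finrank_add_finrank_orthogonal
      have h2 := finrank_columnSpan_le S' z
      rw [finrank_euclideanSpace_fin] at h1
      omega
    have h0 : 0 ≤ lam * ((S \ S').card * b ^ 2 / T) := by positivity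
    have hbase : (√(1 - 2 * (-lam * u)))⁻¹ ≤
        (√(1 + 2 * (lam * ((S \ S').card * b ^ 2 / T))))⁻¹ := by
      have : 0 < √(1 + 2 * (lam * ((S \ S').card * b ^ 2 / T))) := Real.sqrt_pos.2 (by linarith)
      gcongr
      nlinarith
    have hone : (√(1 + 2 * (lam * ((S \ S').card * b ^ 2 / T))))⁻¹ ≤ 1 := by
      refine inv_le_one_of_one_le₀ (Real.one_le_sqrt.2 (by linarith))
    calc _ ≤ (√(1 + 2 * (lam * ((S \ S').card * b ^ 2 / T))))⁻¹ ^
          Module.finrank ℝ (columnSpan S' z)ᗮ := by gcongr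
      _ ≤ _ := pow_le_pow_of_le_one (by positivity) hone hrank
  have hmono := integral_mono (μ := Measure.pi fun _ : Fin T => ρ₁)
    (integrable_of_abs_le hHm hHb).integral_prod_left (integrable_const _) hinner
  simpa using hmono

/-! ### The least squares decoder and the union bound. -/

/-- A measurable family of acceptance regions gives a decoder that returns the accepted support
whenever there is exactly one. -/
lemma exists_decoder_of_acceptance (A : Finset (Fin N) → Set (Design R T N × Outcome R T))
    (hA : ∀ S, MeasurableSet (A S)) :
    ∃ dec : Decoder R T N, ∀ p S, (∀ S', p ∈ A S' ↔ S' = S) → dec.estimate p.1 p.2 = S := by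
  classical
  let accepted : Design R T N × Outcome R T → Finset (Finset (Fin N)) :=
    fun p => Finset.univ.filter fun S => p ∈ A S
  let select : Finset (Finset (Fin N)) → Finset (Fin N) :=
    fun F => if h : ∃ S, F = {S} then h.choose else ∅
  have hacc : ∀ F, MeasurableSet {p | accepted p = F} := fun F => by
    have : {p | accepted p = F} = ⋂ S, {p | p ∈ A S ↔ S ∈ F} := by
      ext p
      simp [accepted, Finset.ext_iff]
    rw [this]
    refine MeasurableSet.iInter fun S => ?_
    by_cases hS : S ∈ F
    · convert! hA S using 1
      ext p; simp [hS]
    · convert! (hA S).compl using 1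
      ext p; simp [hS]
  refine ⟨⟨fun X Y => select (accepted (X, Y)), fun S => ?_⟩, fun p S hp => ?_⟩
  · have : {p : Design R T N × Outcome R T | select (accepted (p.1, p.2)) = S} =
        ⋃ F ∈ {F | select F = S}, {p | accepted p = F} := by
      ext p
      simp
    rw [this]
    exact MeasurableSet.biUnion (Set.to_countable _) fun F _ => hacc F
  · have hF : accepted p = {S} := by
      ext S'
      simp [accepted, hp]
    have hex : ∃ S', ({S} : Finset (Finset (Fin N))) = {S'} := ⟨S, rfl⟩
    have : select {S} = S := by
      simp only [select, dif_pos hex]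
      exact (Finset.singleton_injective hex.choose_spec).symm
    simpa [hF] using this

/-- The total residual of a support in all problems. -/
noncomputable def totalResidual (S : Finset (Fin N)) (X : Design R T N) (Y : Outcome R T) : ℝ :=
  ∑ r, residual S (X r) (Y r)

lemma measurable_totalResidual (S : Finset (Fin N)) :
    Measurable fun p : Design R T N × Outcome R T => totalResidual S p.1 p.2 :=
  Finset.measurable_sum _ fun r _ => (measurable_residual S).comp
    (f := fun p : Design R T N × Outcome R T => (p.1 r, p.2 r)) (by fun_prop)

/-- The event that `S'` fits the outcomes at least as well as the true support `S`. -/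
def confusionEvent (R T : ℕ) (S S' : Finset (Fin N)) :
    Set (Design R T N × Coeff R N × Outcome R T) :=
  {ω | totalResidual S' ω.1 (outcome S ω.1 ω.2.1 ω.2.2) ≤
    totalResidual S ω.1 (outcome S ω.1 ω.2.1 ω.2.2)}

lemma measurableSet_confusionEvent (S S' : Finset (Fin N)) :
    MeasurableSet (confusionEvent R T S S') := by
  have h : ∀ S'', Measurable fun ω : Design R T N × Coeff R N × Outcome R T =>
      totalResidual S'' ω.1 (outcome S ω.1 ω.2.1 ω.2.2) := fun S'' =>
    (measurable_totalResidual S'').comp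
      (g := fun p : Design R T N × Outcome R T => totalResidual S'' p.1 p.2)
      (f := fun ω : Design R T N × Coeff R N × Outcome R T =>
        (ω.1, outcome S ω.1 ω.2.1 ω.2.2)) (measurable_fst.prodMk (measurable_outcome S))
  exact measurableSet_le (h S') (h S)

/-- Least squares: the probability of error is bounded by the pairwise confusion probabilities. -/
lemma exists_decoder_errorProb_le (K : ℕ) (hKN : K ≤ N) (snr : ℝ≥0) (ν : Measure ℝ)
    [IsProbabilityMeasure ν] {B : ℝ}
    (hB : ∀ S ∈ Finset.powersetCard K (Finset.univ : Finset (Fin N)),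
      ∑ S' ∈ (Finset.powersetCard K Finset.univ).erase S,
        (modelLaw R T N snr ν).real (confusionEvent R T S S') ≤ B) :
    ∃ dec : Decoder R T N, errorProb K snr ν dec ≤ B := by
  classical
  set 𝒯 := Finset.powersetCard K (Finset.univ : Finset (Fin N)) with h𝒯
  -- Strict inequality makes at most one support accepted; ties are charged to `confusionEvent`.
  let A : Finset (Fin N) → Set (Design R T N × Outcome R T) := fun S =>
    {p | S ∈ 𝒯 ∧ ∀ S' ∈ 𝒯.erase S, totalResidual S p.1 p.2 < totalResidual S' p.1 p.2}
  have hA : ∀ S, MeasurableSet (A S) := fun S => by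
    have : A S = {p | S ∈ 𝒯} ∩ ⋂ S' ∈ 𝒯.erase S,
        {p | totalResidual S p.1 p.2 < totalResidual S' p.1 p.2} := by
      ext p; simp [A]
    rw [this]
    exact (MeasurableSet.const _).inter (Finset.measurableSet_biInter _ fun S' _ =>
      measurableSet_lt (measurable_totalResidual S) (measurable_totalResidual S'))
  obtain ⟨dec, hdec⟩ := exists_decoder_of_acceptance A hA
  refine ⟨dec, ?_⟩
  have herr : ∀ S ∈ 𝒯, (modelLaw R T N snr ν).real
      {ω | dec.estimate ω.1 (outcome S ω.1 ω.2.1 ω.2.2) ≠ S} ≤ B := by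
    intro S hS
    refine le_trans (measureReal_mono (μ := modelLaw R T N snr ν)
      (s₂ := ⋃ S' ∈ 𝒯.erase S, confusionEvent R T S S') ?_ (measure_ne_top _ _))
      ((measureReal_biUnion_finset_le _ _).trans (hB S hS))
    intro ω hω
    by_contra hcon
    simp only [Set.mem_iUnion, not_exists, confusionEvent, Set.mem_ofPred_eq, not_le] at hcon
    refine hω (hdec (ω.1, outcome S ω.1 ω.2.1 ω.2.2) S fun S' => ⟨fun h => ?_, ?_⟩)
    · by_contra hne
      have h1 := h.2 S (Finset.mem_erase.2 ⟨Ne.symm hne, hS⟩)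
      exact lt_asymm h1 (hcon S' (Finset.mem_erase.2 ⟨hne, h.1⟩))
    · rintro rfl
      exact ⟨hS, hcon⟩
  have hc : (N.choose K : ℝ) ≠ 0 := by exact_mod_cast (Nat.choose_pos hKN).ne'
  calc errorProb K snr ν dec ≤ ∑ S ∈ 𝒯, ((N.choose K : ℝ))⁻¹ * B :=
        Finset.sum_le_sum fun S hS => by gcongr; exact herr S hS
    _ = B := by
      rw [Finset.sum_const, h𝒯, Finset.card_powersetCard, Finset.card_univ, Fintype.card_fin,
        nsmul_eq_mul, ← mul_assoc, mul_inv_cancel₀ hc, one_mul]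

/-- The probability of confusing `S` with `S'`. -/
lemma modelLaw_confusionEvent_le {snr : ℝ≥0} (hsnr : 0 < snr) {ν : Measure ℝ} {σsq bmin : ℝ}
    (h : IsCoeffLaw ν σsq bmin) (S S' : Finset (Fin N)) :
    (modelLaw R T N snr ν).real (confusionEvent R T S S') ≤
      (1 + 2 ^ (S'.card * R)) * ((√(1 + 2 * (snr / 32 * ((S \ S').card * bmin ^ 2 / T))))⁻¹ ^
        (T - S'.card)) ^ R := by
  have := h.isProbabilityMeasure
  rw [modelLaw_real_eq_integral snr ν (measurableSet_confusionEvent S S')]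
  set F : Design R T N × Coeff R N → ℝ := fun z =>
    ∏ r, Real.exp (-(snr / 32) * residual S' (z.1 r) (signal S z.1 z.2 r)) with hF
  have hFm : Measurable F := by
    refine Finset.measurable_prod _ fun r _ => (Measurable.const_mul ?_ _).exp
    exact (measurable_residual S').comp
      (f := fun z : Design R T N × Coeff R N => (z.1 r, signal S z.1 z.2 r))
      (by unfold signal; fun_prop)
  have hFb : ∀ z, |F z| ≤ 1 := fun z => by
    rw [abs_of_nonneg (Finset.prod_nonneg fun r _ => (Real.exp_pos _).le)]
    refine Finset.prod_le_one (fun r _ => (Real.exp_pos _).le) fun r _ => ?_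
    refine Real.exp_le_one_iff.2 (mul_nonpos_of_nonpos_of_nonneg ?_ (residual_nonneg _ _ _))
    have : (0 : ℝ) ≤ snr := snr.coe_nonneg
    linarith
  have hFi := integrable_of_abs_le (μ := (designLaw R T N).prod (coeffLaw R N ν)) hFm hFb
  have hmono := integral_mono (integrable_modelLaw_section snr ν
    (measurableSet_confusionEvent (R := R) (T := T) S S'))
    (hFi.const_mul (1 + 2 ^ (S'.card * R))) fun z => noiseLaw_residual_le hsnr S S' z.1 z.2
  refine hmono.trans ?_
  rw [integral_const_mul]
  gcongr
  -- The design is integrated first, since the resulting bound is uniform over coefficients of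
  -- modulus at least `bmin`.
  rw [integral_prod_symm _ hFi]
  have hae : ∀ᵐ γ ∂(coeffLaw R N ν), ∀ r n, bmin ≤ |γ r n| := by
    rw [ae_all_iff]
    intro r
    rw [ae_all_iff]
    intro n
    exact (measurePreserving_coeff_entry ν r n).quasiMeasurePreserving.ae h.bmin_le
  have hmono2 := integral_mono_ae (μ := coeffLaw R N ν) hFi.integral_prod_right
    (integrable_const (((√(1 + 2 * (snr / 32 * ((S \ S').card * bmin ^ 2 / T))))⁻¹ ^
        (T - S'.card)) ^ R)) (by
      filter_upwards [hae] with γ hγ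
      have hprod : ∫ X, F (X, γ) ∂(designLaw R T N) = _ :=
        integral_fintype_prod_eq_prod (f := fun r (x : Fin T → Fin N → ℝ) =>
          Real.exp (-(snr / 32) * residual S' x fun t => ∑ n ∈ S, x t n * γ r n))
      rw [hprod]
      refine (Finset.prod_le_prod (fun r _ => integral_nonneg fun x => (Real.exp_pos _).le)
        fun r _ => integral_exp_neg_residual_le (by positivity) h.bmin_pos S S' (hγ r)).trans_eq ?_
      simp)
  simpa using hmono2

/-! ### Summing over wrong supports, and the constants. -/

/-- Generating function: over all subsets `S'` the powers `x ^ (S' \ S).card` sum to `2 ^ K * (1 +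
x) ^ (N - K)`. Subsets of `S` account for `2 ^ K` of this and include no other set of size `K`. -/
lemma sum_pow_card_sdiff_le {K : ℕ} {x : ℝ} (hx : 0 ≤ x) {S : Finset (Fin N)}
    (hS : S.card = K) :
    ∑ S' ∈ (Finset.powersetCard K Finset.univ).erase S, x ^ (S \ S').card ≤
      2 ^ K * (Real.exp (N * x) - 1) := by
  classical
  set f : Fin N → ℝ := fun n => if n ∈ S then 1 else x with hf
  have hfS : ∀ S' : Finset (Fin N), ∏ n ∈ S', f n = x ^ (S' \ S).card := fun S' => by
    rw [hf, Finset.prod_ite, Finset.prod_const_one, one_mul, Finset.prod_const,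
      Finset.filter_notMem_eq_sdiff]
  have hall : ∑ S' : Finset (Fin N), x ^ (S' \ S).card = 2 ^ K * (1 + x) ^ (N - K) := by
    simp only [← hfS]
    rw [← Finset.powerset_univ, ← Finset.prod_one_add, hf]
    have : ∀ n, (1 + if n ∈ S then (1 : ℝ) else x) = if n ∈ S then 2 else 1 + x := fun n => by
      split_ifs <;> norm_num
    simp only [this]
    rw [Finset.prod_ite, Finset.prod_const, Finset.prod_const, Finset.filter_notMem_eq_sdiff,
      Finset.card_sdiff_of_subset (Finset.subset_univ _)]
    simp [hS]
  have hsub : ∑ S' ∈ S.powerset, x ^ (S' \ S).card = 2 ^ K := by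
    rw [Finset.sum_congr rfl fun S' hS' => by
      rw [Finset.sdiff_eq_empty_iff_subset.2 (Finset.mem_powerset.1 hS'), Finset.card_empty,
        pow_zero]]
    simp [hS]
  have hdisj : Disjoint ((Finset.powersetCard K Finset.univ).erase S) S.powerset := by
    refine Finset.disjoint_left.2 fun S' h1 h2 => ?_
    obtain ⟨hne, hc⟩ := Finset.mem_erase.1 h1
    refine hne (Finset.eq_of_subset_of_card_le (Finset.mem_powerset.1 h2) ?_)
    rw [hS, (Finset.mem_powersetCard.1 hc).2]
  have hle : ∑ S' ∈ (Finset.powersetCard K Finset.univ).erase S, x ^ (S' \ S).card +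
      ∑ S' ∈ S.powerset, x ^ (S' \ S).card ≤ ∑ S' : Finset (Fin N), x ^ (S' \ S).card := by
    rw [← Finset.sum_union hdisj]
    exact Finset.sum_le_sum_of_subset_of_nonneg (Finset.subset_univ _)
      fun _ _ _ => by positivity
  rw [hall, hsub] at hle
  have hcomm : ∑ S' ∈ (Finset.powersetCard K Finset.univ).erase S, x ^ (S \ S').card =
      ∑ S' ∈ (Finset.powersetCard K Finset.univ).erase S, x ^ (S' \ S).card := by
    refine Finset.sum_congr rfl fun S' hS' => ?_
    rw [Finset.card_sdiff_comm]
    rw [hS, (Finset.mem_powersetCard.1 (Finset.mem_erase.1 hS').2).2]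
  have hexp : (1 + x) ^ (N - K) ≤ Real.exp (N * x) := by
    calc (1 + x) ^ (N - K) ≤ (1 + x) ^ N := pow_le_pow_right₀ (by linarith) (Nat.sub_le _ _)
      _ ≤ Real.exp x ^ N := by
        gcongr
        linarith [Real.add_one_le_exp x]
      _ = Real.exp (N * x) := by rw [Real.exp_nat_mul]
  rw [hcomm]
  have h2 : (0 : ℝ) < 2 ^ K := by positivity
  nlinarith

/-- The pairwise bound in terms of `N`, for enough samples and a large enough total SNR. -/
lemma confusion_bound_le {K i : ℕ} {snr b : ℝ} (hb : 0 < b) (hK : 1 ≤ K) (hR : 1 ≤ R)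
    (hi : 1 ≤ i) (hiK : i ≤ K) (hKN : 2 * K < N) (hKN2 : K ^ 2 ≤ N)
    (hsnr : 256 / Real.log (1 + b ^ 2) * Real.log N ≤ R * snr)
    (hT : 16 * (singleComplexity N K (b ^ 2) / R) ≤ T) (hTK : 2 * K ≤ T) :
    ((√(1 + 2 * (snr / 32 * (i * b ^ 2 / T))))⁻¹ ^ (T - K)) ^ R ≤ (((N : ℝ) ^ 2)⁻¹) ^ i := by
  have hK0 : (0 : ℝ) < K := by exact_mod_cast hK
  have hR0 : (0 : ℝ) < R := by exact_mod_cast hR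
  have hi0 : (0 : ℝ) < i := by exact_mod_cast hi
  have hT0 : (0 : ℝ) < T := by exact_mod_cast (by omega : 0 < T)
  have hN1 : (1 : ℝ) < N := by exact_mod_cast (by omega : 1 < N)
  have hN0 : (0 : ℝ) < N := by linarith
  have hlN : 0 < Real.log N := Real.log_pos hN1
  set ℓ := Real.log (1 + b ^ 2) with hℓ
  have hℓ0 : 0 < ℓ := Real.log_pos (by linarith [pow_pos hb 2])
  set L := Real.log (N / K) with hL
  have hL2 : Real.log N / 2 ≤ L := by
    have h1 : 2 * Real.log K ≤ Real.log N := by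
      have := Real.log_le_log (by positivity) (show (K : ℝ) ^ 2 ≤ N by exact_mod_cast hKN2)
      rwa [Real.log_pow] at this
    rw [hL, Real.log_div hN0.ne' hK0.ne']
    linarith
  have hLle : L ≤ Real.log N := by
    refine Real.log_le_log (by positivity) (div_le_self hN0.le ?_)
    exact_mod_cast hK
  have hL0 : 0 < L := by linarith
  set y := 2 * (snr / 32 * (i * b ^ 2 / T)) with hy
  set u₀ := 16 * (K * L) / ℓ with hu₀
  have hu₀0 : 0 < u₀ := by positivity
  have hu : u₀ ≤ R * T := by
    have h1 : 16 * (K * L / ℓ / R) ≤ T := hT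
    have := mul_le_mul_of_nonneg_left h1 hR0.le
    refine le_trans (le_of_eq ?_) this
    rw [hu₀]; field_simp
  set a := 16 * i * b ^ 2 * Real.log N / ℓ with ha
  have ha0 : 0 ≤ a := by positivity
  have hya : a / (R * T) ≤ y := by
    have e : y = (i * b ^ 2 / 16) * (R * snr) / (R * T) := by rw [hy]; field_simp; ring
    rw [e]
    gcongr
    calc a = (i * b ^ 2 / 16) * (256 / ℓ * Real.log N) := by rw [ha]; ring
      _ ≤ _ := by gcongr
  have hy0 : 0 ≤ y := le_trans (by positivity) hya
  -- Concavity of the logarithm: confusing only `i` of `K` indices costs at least the fraction `i /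
  -- K` of the full exponent.
  have hBern : i / K * ℓ ≤ Real.log (1 + i / K * b ^ 2) := by
    have h1 : (1 : ℝ) ≤ K / i := by
      rw [one_le_div hi0]; exact_mod_cast hiK
    have := mul_log_one_add_div_le one_pos h1 (show 0 ≤ b ^ 2 by positivity)
    rw [div_one, one_mul, ← hℓ, show b ^ 2 / (K / i : ℝ) = i / K * b ^ 2 by field_simp] at this
    calc i / K * ℓ ≤ i / K * (K / i * Real.log (1 + i / K * b ^ 2)) := by gcongr
      _ = _ := by field_simp
  -- The square root and `T - K ≥ T / 2` each cost a factor `2`, so `8` here leaves the exponent `2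
  -- * i` of `N`. The `16` in `u₀` absorbs a further factor `2` from `L ≥ log N / 2`.
  have hmain : 8 * i * Real.log N ≤ R * T * Real.log (1 + y) := by
    have h1 : (i / K : ℝ) * b ^ 2 ≤ a / u₀ := by
      have : a / u₀ = i / K * b ^ 2 * (Real.log N / L) := by
        rw [ha, hu₀]; field_simp
      rw [this]
      exact le_mul_of_one_le_right (by positivity) ((one_le_div hL0).2 hLle)
    calc 8 * i * Real.log N ≤ 16 * i * L := by nlinarith
      _ = u₀ * (i / K * ℓ) := by rw [hu₀]; field_simp
      _ ≤ u₀ * Real.log (1 + i / K * b ^ 2) := by gcongr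
      _ ≤ u₀ * Real.log (1 + a / u₀) := by
        gcongr
      _ ≤ R * T * Real.log (1 + a / (R * T)) := mul_log_one_add_div_le hu₀0 hu ha0
      _ ≤ R * T * Real.log (1 + y) := by gcongr
  have hsub : (T : ℝ) / 2 ≤ (T - K : ℕ) := by
    rw [Nat.cast_sub (by omega)]
    have : (2 * K : ℝ) ≤ T := by exact_mod_cast hTK
    linarith
  have hly : 0 ≤ Real.log (1 + y) := Real.log_nonneg (by linarith)
  rw [← pow_mul, ← Real.log_le_log_iff (by positivity) (by positivity), Real.log_pow,
    Real.log_pow, Real.log_inv, Real.log_inv, Real.log_sqrt (by positivity), Real.log_pow]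
  push_cast
  have : (R * T : ℝ) / 2 * Real.log (1 + y) ≤ ((T - K : ℕ) * R : ℝ) * Real.log (1 + y) := by
    gcongr
    nlinarith
  nlinarith

/-- With a multiple of `K log (N / K) / (R log (1 + bmin²))` samples and a total SNR of order
`log N`, least squares recovers the support. -/
theorem exists_decoder_errorProb_lt {K : ℕ} {snr : ℝ≥0} {ν : Measure ℝ} {σsq bmin ε : ℝ}
    (h : IsCoeffLaw ν σsq bmin) (hK : 1 ≤ K) (hR : 1 ≤ R) (hε : 0 < ε) (hKN : 2 * K < N)
    (hKN2 : K ^ 2 ≤ N) (hNR : R * Real.log (1 + bmin ^ 2) ≤ Real.log N)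
    (hNε : (1 + 2 ^ (K * R)) * (2 ^ K * 2) < ε * N)
    (hsnr : 256 / Real.log (1 + bmin ^ 2) * Real.log N ≤ R * snr)
    (hT : 16 * (singleComplexity N K (bmin ^ 2) / R) ≤ T) :
    ∃ dec : Decoder R T N, errorProb K snr ν dec < ε := by
  classical
  have := h.isProbabilityMeasure
  have hb := h.bmin_pos
  have hK0 : (0 : ℝ) < K := by exact_mod_cast hK
  have hR0 : (0 : ℝ) < R := by exact_mod_cast hR
  have hN1 : (1 : ℝ) < N := by exact_mod_cast (by omega : 1 < N)
  have hN0 : (0 : ℝ) < N := by linarith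
  have hlN : 0 < Real.log N := Real.log_pos hN1
  have hℓ0 : 0 < Real.log (1 + bmin ^ 2) := Real.log_pos (by linarith [pow_pos hb 2])
  have hs : 0 < snr := by
    have : 0 < (R : ℝ) * snr := lt_of_lt_of_le (by positivity) hsnr
    exact_mod_cast pos_of_mul_pos_right this hR0.le
  have hTK : 2 * K ≤ T := by
    have h1 : 2 * Real.log K ≤ Real.log N := by
      have := Real.log_le_log (by positivity) (show (K : ℝ) ^ 2 ≤ N by exact_mod_cast hKN2)
      rwa [Real.log_pow] at this
    have h2 : (2 * K : ℝ) ≤ T := by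
      refine le_trans ?_ hT
      rw [singleComplexity, Real.log_div hN0.ne' hK0.ne', div_div, ← mul_div_assoc,
        le_div_iff₀ (by positivity)]
      nlinarith
    exact_mod_cast h2
  set x : ℝ := ((N : ℝ) ^ 2)⁻¹ with hx
  obtain ⟨dec, hdec⟩ := exists_decoder_errorProb_le (R := R) (T := T) K (by omega : K ≤ N) snr ν
    (B := (1 + 2 ^ (K * R)) * (2 ^ K * (Real.exp (N * x) - 1))) (by
      intro S hS
      have hSc := (Finset.mem_powersetCard.1 hS).2
      refine le_trans (Finset.sum_le_sum (g := fun S' => (1 + 2 ^ (K * R)) * x ^ (S \ S').card)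
        fun S' hS' => ?_) ?_
      · obtain ⟨hne, hS'⟩ := Finset.mem_erase.1 hS'
        have hSc' := (Finset.mem_powersetCard.1 hS').2
        refine (modelLaw_confusionEvent_le hs h S S').trans ?_
        rw [hSc']
        gcongr
        refine confusion_bound_le hb hK hR ?_ ?_ hKN hKN2 hsnr hT hTK
        · rw [Nat.one_le_iff_ne_zero, Finset.card_ne_zero, Finset.sdiff_nonempty]
          exact fun hsub => hne (Finset.eq_of_subset_of_card_le hsub (by omega)).symm
        · exact (Finset.card_le_card Finset.sdiff_subset).trans_eq hSc
      · rw [← Finset.mul_sum]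
        gcongr
        exact sum_pow_card_sdiff_le (by positivity) hSc)
  refine ⟨dec, hdec.trans_lt ?_⟩
  -- With `x = N ^ (-2)` the sum over wrong supports is `O(1 / N)`.
  have hNx : N * x = (N : ℝ)⁻¹ := by rw [hx]; field_simp
  have hexp : Real.exp (N * x) - 1 ≤ 2 * (N : ℝ)⁻¹ := by
    rw [hNx]
    have := Real.abs_exp_sub_one_le (x := (N : ℝ)⁻¹) (by
      rw [abs_of_pos (by positivity)]
      exact inv_le_one_of_one_le₀ hN1.le)
    rw [abs_of_pos (show 0 < (N : ℝ)⁻¹ by positivity)] at this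
    exact (le_abs_self _).trans this
  calc _ ≤ (1 + 2 ^ (K * R)) * (2 ^ K * (2 * (N : ℝ)⁻¹)) := by gcongr
    _ = (1 + 2 ^ (K * R)) * (2 ^ K * 2) * (N : ℝ)⁻¹ := by ring
    _ < ε * N * (N : ℝ)⁻¹ := by gcongr
    _ = ε := by field_simp

end MultiRegression

open MultiRegression in
theorem theorem6 :
    -- Necessary condition on the SNR: the total SNR is of order at least `log N`.
    (∃ c : ℝ, 0 < c ∧ ∃ δ : ℝ, 0 < δ ∧ ∃ N₀ : ℕ,
      ∀ (N K R T : ℕ) (snr : ℝ≥0) (ν : Measure ℝ) (σsq bmin : ℝ),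
        N₀ ≤ N → 1 ≤ K → 2 * K < N → 1 ≤ R → 0 < snr → IsCoeffLaw ν σsq bmin →
        (R : ℝ) * snr < c * (Real.log N / σsq) →
        ∀ dec : Decoder R T N, δ ≤ errorProb K snr ν dec) ∧
    -- Necessary condition on the number of samples per problem.
    (∀ κ : ℝ, 0 < κ → ∃ c : ℝ, 0 < c ∧ ∃ δ : ℝ, 0 < δ ∧ ∃ N₀ : ℕ,
      ∀ (N K R T : ℕ) (snr : ℝ≥0) (ν : Measure ℝ) (σsq bmin : ℝ),
        N₀ ≤ N → 1 ≤ K → 2 * K < N → 1 ≤ R → 0 < snr → IsCoeffLaw ν σsq bmin →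
        (R : ℝ) * snr ≤ κ * Real.log (N / K) →
        (T : ℝ) < c * (singleComplexity N K σsq / R) →
        ∀ dec : Decoder R T N, δ ≤ errorProb K snr ν dec) ∧
    -- Sufficient condition on the number of samples per problem.
    (∃ C : ℝ, 0 < C ∧ ∀ bmin : ℝ, 0 < bmin → ∃ κ : ℝ, 0 < κ ∧
      ∀ (K R : ℕ) (ν : Measure ℝ) (σsq : ℝ), 1 ≤ K → 1 ≤ R → IsCoeffLaw ν σsq bmin →
        ∀ ε : ℝ, 0 < ε → ∃ N₀ : ℕ, ∀ (N T : ℕ) (snr : ℝ≥0), N₀ ≤ N → 2 * K < N →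
          κ * Real.log N ≤ (R : ℝ) * snr →
          C * (singleComplexity N K (bmin ^ 2) / R) ≤ (T : ℝ) →
          ∃ dec : Decoder R T N, errorProb K snr ν dec < ε) := by
  have le_log : ∀ {a : ℝ} {n : ℕ}, ⌈Real.exp a⌉₊ ≤ n → a ≤ Real.log n := fun {a n} h => by
    have h1 : Real.exp a ≤ n := Nat.ceil_le.1 h
    exact (Real.le_log_iff_exp_le ((Real.exp_pos a).trans_le h1)).2 h1
  refine ⟨⟨1 / 2, by norm_num, 1 / 2, by norm_num, ⌈Real.exp 6⌉₊, ?_⟩, fun κ hκ => ?_,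
    ⟨16, by norm_num, fun bmin hb => ?_⟩⟩
  · intro N K R T snr ν σsq bmin hN hK hKN _ hsnr h hR dec
    exact half_le_errorProb_of_snr_lt (le_log hN) hK hKN hsnr h hR dec
  · obtain ⟨c, hc, hcap⟩ := exists_capacity_constant hκ
    refine ⟨c, hc, 1 / 2, by norm_num, ⌈12 * Real.exp 8⌉₊, ?_⟩
    intro N K R T snr ν σsq bmin hN hK hKN hR hsnr h hsnrκ hT dec
    exact half_le_errorProb_of_samples_lt hκ hc hcap (Nat.ceil_le.1 hN) hK hKN hR hsnr h hsnrκ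
      hT dec
  · have hℓ : 0 < Real.log (1 + bmin ^ 2) := Real.log_pos (by linarith [pow_pos hb 2])
    refine ⟨256 / Real.log (1 + bmin ^ 2), by positivity, ?_⟩
    intro K R ν σsq hK hR h ε hε
    -- The summands ensure in turn `K ^ 2 ≤ N`, the bound on `R` that yields `2 * K ≤ T`, and a
    -- final error below `ε`.
    refine ⟨K ^ 2 + ⌈Real.exp (R * Real.log (1 + bmin ^ 2))⌉₊ +
      (⌊(1 + 2 ^ (K * R)) * (2 ^ K * 2) / ε⌋₊ + 1), ?_⟩
    intro N T snr hN hKN hsnr hT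
    refine exists_decoder_errorProb_lt h hK hR hε hKN (by omega) (le_log (by omega)) ?_ hsnr hT
    have h1 := Nat.lt_floor_add_one ((1 + 2 ^ (K * R)) * (2 ^ K * 2) / ε)
    rw [div_lt_iff₀ hε] at h1
    refine h1.trans_le ?_
    rw [mul_comm]
    gcongr
    exact_mod_cast (by omega : ⌊(1 + 2 ^ (K * R)) * (2 ^ K * 2) / ε⌋₊ + 1 ≤ N)
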